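/- Let $R$ be a commutative ring with unit and let $X=\{x_1<\dots<x_n\}$ be a finite totally ordered alphabet. Consider the free $R$-algebra on $X$ with two bilinear brackets $[\cdot,\cdot]$ and $\langle\cdot,\cdot\rangle$ that are both antisymmetric, both satisfy the Jacobi identity, and are compatible, i.e. satisfy the mixed Jacobi identity $$[x,\langle y,z\rangle]+[y,\langle z,x\rangle]+[z,\langle x,y\rangle]+\langle x,[y,z]\rangle+\langle y,[z,x]\rangle+\langle z,[x,y]\rangle=0 .$$ Let $\mathrm{Lie}_2(n)$ be its multilinear part, that is, the submodule spanned by the values of all monomials in $M_n$, where $M_n$ is the set of formal bracket monomials (plane binary trees with leaves labelled by $X$ and each internal vertex carrying one of the two brackets) in which every letter of $X$ occurs exactly once. For a monomial $m$ define its graphical root $\operatorname{gr}(m)\in X$ and its two-coloured graph $\mathcal G(m)$ recursively. If $m=x$ is a letter, then $\operatorname{gr}(m)=x$ and $\mathcal G(m)$ is the single vertex $x$. Further, $\operatorname{gr}([m_1,m_2])=\min\{\operatorname{gr}(m_1),\operatorname{gr}(m_2)\}$ and $\operatorname{gr}(\langle m_1,m_2\rangle)=\max\{\operatorname{gr}(m_1),\operatorname{gr}(m_2)\}$.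 If $m=[m_1,m_2]$ (respectively $m=\langle m_1,m_2\rangle$), then $\mathcal G(m)$ is obtained from $\mathcal G(m_1)$ and $\mathcal G(m_2)$ by adding a red (respectively blue) edge between $\operatorname{gr}(m_1)$ and $\operatorname{gr}(m_2)$. Let $\overline{\mathcal G}_n$ be the set of trees with vertex set $X$ whose edges are coloured red or blue such that there are no $i<j<k$ in $X$ for which $\{i,k\},\{j,k\}$ are both red edges, or $\{i,j\},\{i,k\}$ are both blue edges, or $\{i,j\}$ is a red edge and $\{j,k\}$ is a blue edge. (These correspond bijectively to the rooted trees on $X$: an edge is red if its endpoint closer to the root is the smaller one, and blue otherwise.) **Theorem.** Let $S\subseteq M_n$ be a set of monomials such that $\mathcal G$ restricts to a bijection from $S$ onto $\overline{\mathcal G}_n$. Then $S$ is a basis of the $R$-module $\mathrm{Lie}_2(n)$. -/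

import Mathlib

/-- The two colours; red is the colour of `[·,·]` and blue is the colour of `⟨·,·⟩`. -/
inductive BracketColor : Type
  | red : BracketColor
  | blue : BracketColor
  deriving DecidableEq

/-- Formal monomials in the letters `X` with two binary brackets, i.e. plane binary trees with
leaves labelled by `X` and internal vertices coloured red or blue: `br red a b` is `[a, b]` and
`br blue a b` is `⟨a, b⟩`. -/
inductive BracketMonomial (X : Type*) : Type _
  | letter (x : X) : BracketMonomial X
  | br (c : BracketColor) (a b : BracketMonomial X) : BracketMonomial X

namespace BracketMonomial

/-- The list of letters of a monomial, from left to right. -/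
def letters {X : Type*} : BracketMonomial X → List X
  | letter x => [x]
  | br _ a b => a.letters ++ b.letters

/-- Each letter of the alphabet occurs exactly once. -/
def IsMultilinear {X : Type*} [DecidableEq X] (m : BracketMonomial X) : Prop :=
  ∀ x : X, m.letters.count x = 1

end BracketMonomial

/-- The set `M_n` of multilinear monomials on the alphabet `X`, as a type. -/
abbrev MultilinearMonomial (X : Type*) [DecidableEq X] : Type _ :=
  {m : BracketMonomial X // m.IsMultilinear}

section FreeAlgebra

variable (R : Type*) [CommRing R] (X : Type*)

/-- The free `R`-module on all formal monomials: the free algebra with two bilinear operations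
that satisfy no identities. -/
abbrev FreeTwoBracket : Type _ := BracketMonomial X →₀ R

/-- The bilinear operation of colour `c` on `FreeTwoBracket R X`, which sends a pair of
monomials `(a, b)` to the monomial `br c a b`. -/
noncomputable def freeTwoBracketOp (c : BracketColor) :
    FreeTwoBracket R X →ₗ[R] FreeTwoBracket R X →ₗ[R] FreeTwoBracket R X :=
  Finsupp.linearCombination R
    (fun a : BracketMonomial X => Finsupp.lmapDomain R R (BracketMonomial.br c a))

/-- `I` is a two-sided ideal for both brackets that contains all instances of the antisymmetry
and Jacobi identities of both brackets and of the mixed Jacobi identity. -/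
structure IsCompatibleLieIdeal (I : Submodule R (FreeTwoBracket R X)) : Prop where
  op_left_mem : ∀ (c : BracketColor) (x y : FreeTwoBracket R X), x ∈ I →
    freeTwoBracketOp R X c x y ∈ I
  op_right_mem : ∀ (c : BracketColor) (x y : FreeTwoBracket R X), y ∈ I →
    freeTwoBracketOp R X c x y ∈ I
  antisymm_mem : ∀ (c : BracketColor) (x y : FreeTwoBracket R X),
    freeTwoBracketOp R X c x y + freeTwoBracketOp R X c y x ∈ I
  jacobi_mem : ∀ (c : BracketColor) (x y z : FreeTwoBracket R X),
    freeTwoBracketOp R X c x (freeTwoBracketOp R X c y z)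
      + freeTwoBracketOp R X c y (freeTwoBracketOp R X c z x)
      + freeTwoBracketOp R X c z (freeTwoBracketOp R X c x y) ∈ I
  mixed_jacobi_mem : ∀ x y z : FreeTwoBracket R X,
    freeTwoBracketOp R X .red x (freeTwoBracketOp R X .blue y z)
      + freeTwoBracketOp R X .red y (freeTwoBracketOp R X .blue z x)
      + freeTwoBracketOp R X .red z (freeTwoBracketOp R X .blue x y)
      + freeTwoBracketOp R X .blue x (freeTwoBracketOp R X .red y z)
      + freeTwoBracketOp R X .blue y (freeTwoBracketOp R X .red z x)
      + freeTwoBracketOp R X .blue z (freeTwoBracketOp R X .red x y) ∈ I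

/-- The ideal generated by the identities of a pair of compatible Lie brackets. -/
noncomputable def compatibleLieIdeal : Submodule R (FreeTwoBracket R X) :=
  sInf {I | IsCompatibleLieIdeal R X I}

theorem isCompatibleLieIdeal_compatibleLieIdeal :
    IsCompatibleLieIdeal R X (compatibleLieIdeal R X) where
  op_left_mem c x y hx := by
    simp only [compatibleLieIdeal, Submodule.mem_sInf, Set.mem_ofPred_eq] at hx ⊢
    exact fun I hI => hI.op_left_mem c x y (hx I hI)
  op_right_mem c x y hy := by
    simp only [compatibleLieIdeal, Submodule.mem_sInf, Set.mem_ofPred_eq] at hy ⊢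
    exact fun I hI => hI.op_right_mem c x y (hy I hI)
  antisymm_mem c x y := by
    simp only [compatibleLieIdeal, Submodule.mem_sInf, Set.mem_ofPred_eq]
    exact fun I hI => hI.antisymm_mem c x y
  jacobi_mem c x y z := by
    simp only [compatibleLieIdeal, Submodule.mem_sInf, Set.mem_ofPred_eq]
    exact fun I hI => hI.jacobi_mem c x y z
  mixed_jacobi_mem x y z := by
    simp only [compatibleLieIdeal, Submodule.mem_sInf, Set.mem_ofPred_eq]
    exact fun I hI => hI.mixed_jacobi_mem x y z

/-- The free `R`-algebra on `X` with two compatible Lie brackets. -/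
abbrev FreeCompatibleLie : Type _ := FreeTwoBracket R X ⧸ compatibleLieIdeal R X

/-- The Lie bracket of colour `c` on the free algebra with two compatible Lie brackets. -/
noncomputable def freeCompatibleBracket (c : BracketColor) :
    FreeCompatibleLie R X →ₗ[R] FreeCompatibleLie R X →ₗ[R] FreeCompatibleLie R X :=
  (compatibleLieIdeal R X).liftQ
    (LinearMap.mk₂ R
      (fun (x : FreeTwoBracket R X) (y : FreeCompatibleLie R X) =>
        (compatibleLieIdeal R X).mapQ (compatibleLieIdeal R X) (freeTwoBracketOp R X c x)
          (fun z hz =>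
            (isCompatibleLieIdeal_compatibleLieIdeal R X).op_right_mem c x z hz) y)
      (fun x x' y => by
        obtain ⟨y, rfl⟩ := Submodule.Quotient.mk_surjective _ y
        simp)
      (fun r x y => by
        obtain ⟨y, rfl⟩ := Submodule.Quotient.mk_surjective _ y
        simp)
      (fun x y y' => by simp)
      (fun r x y => by simp))
    (fun x hx => by
      rw [LinearMap.mem_ker]
      ext y
      simpa using (isCompatibleLieIdeal_compatibleLieIdeal R X).op_left_mem c x _ hx)

/-- The value of a formal monomial in the free algebra with two compatible Lie brackets. -/
noncomputable def BracketMonomial.eval {X : Type*} :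
    BracketMonomial X → FreeCompatibleLie R X
  | .letter x => (compatibleLieIdeal R X).mkQ (Finsupp.single (.letter x) 1)
  | .br c a b => freeCompatibleBracket R X c a.eval b.eval

/-- `Lie₂(n)`, `n = |X|`: the multilinear part of the free algebra on `X` with two compatible Lie
brackets, spanned by the monomials that contain each letter exactly once. -/
noncomputable def Lie₂ [DecidableEq X] : Submodule R (FreeCompatibleLie R X) :=
  Submodule.span R (Set.range (fun m : MultilinearMonomial X => m.1.eval R))

end FreeAlgebra

/-- A graph on `X` with edges coloured red and blue, given by the graphs of its edges of
either colour. -/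
abbrev TwoColoredGraph (X : Type*) : Type _ := BracketColor → SimpleGraph X

/-- `G` is a two-coloured tree on the vertex set `X`: every edge has only one colour and the
underlying graph is a tree. -/
structure TwoColoredGraph.IsTwoColoredTree {X : Type*} (G : TwoColoredGraph X) : Prop where
  disjoint : Disjoint (G .red) (G .blue)
  isTree : (G .red ⊔ G .blue).IsTree

/-- `G` avoids the patterns `1r3r2`, `2b1b3` and `1r2b3`. -/
structure TwoColoredGraph.AvoidsPatterns {X : Type*} [LinearOrder X]
    (G : TwoColoredGraph X) : Prop where
  not_1r3r2 : ∀ i j k : X, i < j → j < k → ¬ ((G .red).Adj i k ∧ (G .red).Adj j k)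
  not_2b1b3 : ∀ i j k : X, i < j → j < k → ¬ ((G .blue).Adj i j ∧ (G .blue).Adj i k)
  not_1r2b3 : ∀ i j k : X, i < j → j < k → ¬ ((G .red).Adj i j ∧ (G .blue).Adj j k)

/-- The set of two-coloured trees on `X` that avoid the three patterns. These correspond
to the rooted trees on `X`: an edge is red if its end closer to the root is its smaller end, and
blue otherwise. -/
def twoColoredRootedTrees (X : Type*) [LinearOrder X] : Set (TwoColoredGraph X) :=
  {G | G.IsTwoColoredTree ∧ G.AvoidsPatterns}

namespace BracketMonomial

/-- The graphical root of a monomial. -/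
def graphicalRoot {X : Type*} [LinearOrder X] : BracketMonomial X → X
  | letter x => x
  | br .red a b => min a.graphicalRoot b.graphicalRoot
  | br .blue a b => max a.graphicalRoot b.graphicalRoot

/-- The two-coloured graph of a monomial: a letter gives no edges, and `br c a b` gives the union
of the graphs of `a` and `b` and an edge of colour `c` between their graphical roots. -/
def graph {X : Type*} [LinearOrder X] : BracketMonomial X → TwoColoredGraph X
  | letter _ => fun _ => ⊥
  | br c a b => fun c' => a.graph c' ⊔ b.graph c' ⊔
      (if c' = c then SimpleGraph.edge a.graphicalRoot b.graphicalRoot else ⊥)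

end BracketMonomial

/-! A monomial carries a rooted tree: a product of colour `c` adds the arc from its graphical root
to the other of the two roots, and this arc is red exactly when the parent is the smaller end. Hence
the coloured graph and the arc set `arcs` determine each other, and `S` has exactly one monomial for
each tree of a multilinear monomial.

Everything rests on `Compat T m`: for each product inside `m`, some arc of `T` of the right colour
leads from one factor to the root of `T` restricted to the other factor. By `arcs_eq_or_treeKey_lt`,
a tree of a multilinear monomial that is compatible with `m` is `m.arcs` or has a smaller `treeKey`.
The first entry of the key adds the ranks of the red children and subtracts those of the blue
children. Ties are broken lexicographically by depth, with the positive weight `K - signedValue` for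
each child.

Independence: the brackets `{u^s, u^t} = w(s,t) u^(s+t)` for antisymmetric `w` are Lie and pairwise
compatible. With the signed adjacency matrices of the red and blue arcs of `T` as the two `w`, the
coefficient of the value of `m` vanishes unless `T` is compatible with `m`, and it is `±1` if `T =
m.arcs`. The pairing of trees and monomials is therefore triangular with units on the diagonal, over
every `R`.

Spanning: by the Jacobi and mixed Jacobi identities, two consecutive factors attached to the same
root can be exchanged modulo monomials with smaller trees (`Sim.exchange`). So monomials with the
same tree agree up to sign modulo smaller ones (`sim_of_arcs_eq`), and induction on the key finishes
the proof. -/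

/-! ### Rooted trees of monomials and compatibility. -/

/-- The colour of an arc from a parent `i` to a child `j`. -/
def arcColor {X : Type*} [LinearOrder X] (i j : X) : BracketColor :=
  if i < j then .red else .blue

theorem arcColor_eq_or {X : Type*} [LinearOrder X] {i j : X} (h : i ≠ j) (c : BracketColor) :
    arcColor i j = c ∨ arcColor j i = c := by
  rcases lt_or_gt_of_ne h with h | h <;> cases c <;> simp [arcColor, h, h.not_gt]

theorem arcColor_ne_swap {X : Type*} [LinearOrder X] {i j : X} (h : i ≠ j) :
    arcColor i j ≠ arcColor j i := by
  rcases lt_or_gt_of_ne h with h | h <;> simp [arcColor, h, h.not_gt]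

/-- The sign attached to a colour. -/
def BracketColor.sign : BracketColor → ℤ
  | .red => 1
  | .blue => -1

theorem BracketColor.abs_sign_mul (c : BracketColor) (z : ℤ) : |c.sign * z| = |z| := by
  cases c <;> simp [BracketColor.sign]

theorem sign_mul_lt {X : Type*} [LinearOrder X] {f : X → ℤ} (hf : StrictMono f) {i j : X}
    (h : i ≠ j) : (arcColor i j).sign * f i < (arcColor i j).sign * f j := by
  rcases lt_or_gt_of_ne h with h | h
  · have := hf h
    simp [arcColor, h, BracketColor.sign, this]
  · have := hf h
    simp [arcColor, h.not_gt, BracketColor.sign, this]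

namespace BracketMonomial

theorem nodup_br {X : Type*} {c : BracketColor} {a b : BracketMonomial X} :
    (br c a b).letters.Nodup ↔
      a.letters.Nodup ∧ b.letters.Nodup ∧ a.letters.Disjoint b.letters := by
  simp [letters, List.nodup_append']

theorem mem_letters_br {X : Type*} {c : BracketColor} {a b : BracketMonomial X} {x : X} :
    x ∈ (br c a b).letters ↔ x ∈ a.letters ∨ x ∈ b.letters := by
  simp [letters]

theorem mem_letters_swap {X : Type*} {c : BracketColor} {a b : BracketMonomial X} {x : X} :
    x ∈ (br c b a).letters ↔ x ∈ (br c a b).letters := by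
  simp [letters, or_comm]

theorem nodup_swap {X : Type*} {c : BracketColor} {a b : BracketMonomial X}
    (hm : (br c a b).letters.Nodup) : (br c b a).letters.Nodup := by
  obtain ⟨ha, hb, hd⟩ := nodup_br.1 hm
  exact nodup_br.2 ⟨hb, ha, hd.symm⟩

section Arcs

variable {X : Type*} [LinearOrder X]

/-- The arcs of the rooted tree of a monomial, from parents to children. -/
def arcs : BracketMonomial X → Finset (X × X)
  | letter _ => ∅
  | br c a b =>
      insert (if arcColor a.graphicalRoot b.graphicalRoot = c
        then (a.graphicalRoot, b.graphicalRoot) else (b.graphicalRoot, a.graphicalRoot))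
        (a.arcs ∪ b.arcs)

/-- The graphical root of `a` is the graphical root of `br c a b`. -/
structure Wins (c : BracketColor) (a b : BracketMonomial X) : Prop where
  ne : a.graphicalRoot ≠ b.graphicalRoot
  color : arcColor a.graphicalRoot b.graphicalRoot = c

theorem wins_or {a b : BracketMonomial X} (h : a.graphicalRoot ≠ b.graphicalRoot)
    (c : BracketColor) : Wins c a b ∨ Wins c b a :=
  (arcColor_eq_or h c).imp (fun h' => ⟨h, h'⟩) (fun h' => ⟨h.symm, h'⟩)

theorem graphicalRoot_comm (c : BracketColor) (a b : BracketMonomial X) :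
    (br c a b).graphicalRoot = (br c b a).graphicalRoot := by
  cases c
  · exact min_comm _ _
  · exact max_comm _ _

theorem arcs_comm (c : BracketColor) (a b : BracketMonomial X) :
    (br c a b).arcs = (br c b a).arcs := by
  simp only [arcs, Finset.union_comm b.arcs a.arcs]
  by_cases h : a.graphicalRoot = b.graphicalRoot
  · simp [h]
  · have h1 := arcColor_ne_swap h
    rcases arcColor_eq_or h c with h2 | h2
    · rw [if_pos h2, if_neg (fun h3 => h1 (h2.trans h3.symm))]
    · rw [if_pos h2, if_neg (fun h3 => h1 (h3.trans h2.symm))]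

theorem Wins.root {c : BracketColor} {a b : BracketMonomial X} (h : Wins c a b) :
    (br c a b).graphicalRoot = a.graphicalRoot := by
  obtain ⟨h1, rfl⟩ := h
  rcases lt_or_gt_of_ne h1 with h | h
  · simp [arcColor, h, graphicalRoot, h.le]
  · simp [arcColor, h.not_gt, graphicalRoot, h.le]

theorem Wins.arcs {c : BracketColor} {a b : BracketMonomial X} (h : Wins c a b) :
    (br c a b).arcs = insert (a.graphicalRoot, b.graphicalRoot) (a.arcs ∪ b.arcs) := by
  simp [BracketMonomial.arcs, h.color]

theorem graphicalRoot_mem (m : BracketMonomial X) : m.graphicalRoot ∈ m.letters := by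
  induction m with
  | letter x => simp [graphicalRoot, letters]
  | br c a b iha ihb =>
    cases c
    · rcases min_choice a.graphicalRoot b.graphicalRoot with h | h <;>
        simp [graphicalRoot, letters, h, iha, ihb]
    · rcases max_choice a.graphicalRoot b.graphicalRoot with h | h <;>
        simp [graphicalRoot, letters, h, iha, ihb]

theorem root_ne_of_nodup {c : BracketColor} {a b : BracketMonomial X}
    (h : (br c a b).letters.Nodup) : a.graphicalRoot ≠ b.graphicalRoot := fun h' =>
  (nodup_br.1 h).2.2 a.graphicalRoot_mem (h' ▸ b.graphicalRoot_mem)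

/-- Induction on monomials without repeated letters, where up to a swap the graphical root of a
product is the graphical root of its first factor. -/
theorem nodup_induction {P : ∀ m : BracketMonomial X, m.letters.Nodup → Prop}
    (hl : ∀ x h, P (letter x) h)
    (hs : ∀ c a b h' h, P (br c b a) h' → P (br c a b) h)
    (hbr : ∀ c a b h, Wins c a b → P a (nodup_br.1 h).1 → P b (nodup_br.1 h).2.1 →
      P (br c a b) h)
    (m : BracketMonomial X) (hm : m.letters.Nodup) : P m hm := by
  induction m with
  | letter x => exact hl x hm
  | br c a b iha ihb =>
    obtain ⟨ha, hb, hd⟩ := nodup_br.1 hm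
    rcases wins_or (root_ne_of_nodup hm) c with h | h
    · exact hbr c a b hm h (iha ha) (ihb hb)
    · exact hs c a b _ hm (hbr c b a (nodup_br.2 ⟨hb, ha, hd.symm⟩) h (ihb hb) (iha ha))

theorem mem_of_mem_arcs {m : BracketMonomial X} {i j : X} (h : (i, j) ∈ m.arcs) :
    i ∈ m.letters ∧ j ∈ m.letters := by
  induction m with
  | letter x => simp [arcs] at h
  | br c a b iha ihb =>
    simp only [mem_letters_br]
    have := a.graphicalRoot_mem
    have := b.graphicalRoot_mem
    simp only [arcs, Finset.mem_insert, Finset.mem_union] at h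
    rcases h with h | h | h
    · split_ifs at h <;> (rw [Prod.mk.injEq] at h; obtain ⟨rfl, rfl⟩ := h; tauto)
    · have := iha h
      tauto
    · have := ihb h
      tauto

theorem mem_arcs_left {c : BracketColor} {a b : BracketMonomial X}
    (hm : (br c a b).letters.Nodup) {i j : X} :
    (i, j) ∈ a.arcs ↔ (i, j) ∈ (br c a b).arcs ∧ i ∈ a.letters ∧ j ∈ a.letters := by
  obtain ⟨ha, hb, hd⟩ := nodup_br.1 hm
  refine ⟨fun h => ⟨by simp [arcs, h], mem_of_mem_arcs h⟩, fun ⟨h, hi, hj⟩ => ?_⟩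
  simp only [arcs, Finset.mem_insert, Finset.mem_union] at h
  rcases h with h | h | h
  · split_ifs at h <;> rw [Prod.mk.injEq] at h
    · exact (hd hj (h.2 ▸ b.graphicalRoot_mem)).elim
    · exact (hd hi (h.1 ▸ b.graphicalRoot_mem)).elim
  · exact h
  · exact (hd hi (mem_of_mem_arcs h).1).elim

theorem mem_arcs_right {c : BracketColor} {a b : BracketMonomial X}
    (hm : (br c a b).letters.Nodup) {i j : X} :
    (i, j) ∈ b.arcs ↔ (i, j) ∈ (br c a b).arcs ∧ i ∈ b.letters ∧ j ∈ b.letters := by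
  rw [arcs_comm]
  exact mem_arcs_left (nodup_swap hm)

theorem not_mem_arcs_root {m : BracketMonomial X} (hm : m.letters.Nodup) :
    ∀ i, (i, m.graphicalRoot) ∉ m.arcs := by
  induction m, hm using nodup_induction with
  | hl x _ => simp [arcs]
  | hs c a b _ _ h => rwa [arcs_comm, graphicalRoot_comm]
  | hbr c a b hm hw ha hb =>
    intro i hi
    have hd := (nodup_br.1 hm).2.2
    rw [hw.arcs, hw.root, Finset.mem_insert, Finset.mem_union, Prod.mk.injEq] at hi
    rcases hi with hi | hi | hi
    · exact hw.ne hi.2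
    · exact ha i hi
    · exact hd a.graphicalRoot_mem (mem_of_mem_arcs hi).2

/-- Every vertex is the head of at most one arc. -/
def IndegreeLeOne (T : Finset (X × X)) : Prop :=
  ∀ ⦃i j k : X⦄, (i, k) ∈ T → (j, k) ∈ T → i = j

theorem indegreeLeOne_arcs {m : BracketMonomial X} (hm : m.letters.Nodup) :
    IndegreeLeOne m.arcs := by
  induction m, hm using nodup_induction with
  | hl x _ => intro i j k h; simp [arcs] at h
  | hs c a b _ _ h => rwa [arcs_comm]
  | hbr c a b hm hw ha hb =>
    obtain ⟨hna, hnb, hd⟩ := nodup_br.1 hm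
    intro i j k hi hj
    rw [hw.arcs, Finset.mem_insert, Finset.mem_union, Prod.mk.injEq] at hi hj
    rcases hi with hi | hi | hi <;> rcases hj with hj | hj | hj
    · exact hi.1.trans hj.1.symm
    · exact (hd (mem_of_mem_arcs hj).2 (hi.2 ▸ b.graphicalRoot_mem)).elim
    · exact (not_mem_arcs_root hnb j (hi.2 ▸ hj)).elim
    · exact (hd (mem_of_mem_arcs hi).2 (hj.2 ▸ b.graphicalRoot_mem)).elim
    · exact ha hi hj
    · exact (hd (mem_of_mem_arcs hi).2 (mem_of_mem_arcs hj).2).elim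
    · exact (not_mem_arcs_root hnb i (hj.2 ▸ hi)).elim
    · exact (hd (mem_of_mem_arcs hj).2 (mem_of_mem_arcs hi).2).elim
    · exact hb hi hj

theorem ne_of_mem_arcs {m : BracketMonomial X} (hm : m.letters.Nodup) :
    ∀ i j, (i, j) ∈ m.arcs → i ≠ j := by
  induction m, hm using nodup_induction with
  | hl x _ => simp [arcs]
  | hs c a b _ _ h => rwa [arcs_comm]
  | hbr c a b hm hw ha hb =>
    intro i j h
    rw [hw.arcs, Finset.mem_insert, Finset.mem_union, Prod.mk.injEq] at h
    rcases h with ⟨rfl, rfl⟩ | h | h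
    · exact hw.ne
    · exact ha i j h
    · exact hb i j h

/-- The tree of a monomial is connected. -/
theorem forall_letters_of_arcs {m : BracketMonomial X} (hm : m.letters.Nodup) (P : X → Prop) :
    (∀ i j, (i, j) ∈ m.arcs → (P i ↔ P j)) → P m.graphicalRoot → ∀ x ∈ m.letters, P x := by
  induction m, hm using nodup_induction with
  | hl x _ => simp [letters, graphicalRoot]
  | hs c a b _ _ h =>
    rw [arcs_comm, graphicalRoot_comm]
    simpa only [mem_letters_swap] using h
  | hbr c a b hm hw ha hb =>
    intro h h0 x hx
    rw [hw.root] at h0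
    have hab := h a.graphicalRoot b.graphicalRoot (by simp [hw.arcs])
    rcases mem_letters_br.1 hx with hx | hx
    · exact ha (fun i j hij => h i j (by simp [hw.arcs, hij])) h0 x hx
    · exact hb (fun i j hij => h i j (by simp [hw.arcs, hij])) (hab.1 h0) x hx

theorem exists_mem_arcs {m : BracketMonomial X} (hm : m.letters.Nodup) :
    ∀ x ∈ m.letters, x ≠ m.graphicalRoot → ∃ i, (i, x) ∈ m.arcs := by
  induction m, hm using nodup_induction with
  | hl x _ => simp [letters, graphicalRoot]
  | hs c a b _ _ h =>
    rw [arcs_comm, graphicalRoot_comm]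
    simpa only [mem_letters_swap] using h
  | hbr c a b hm hw ha hb =>
    intro x hx hx0
    rw [hw.root] at hx0
    rw [hw.arcs]
    rcases mem_letters_br.1 hx with hx | hx
    · obtain ⟨i, hi⟩ := ha x hx hx0
      exact ⟨i, by simp [hi]⟩
    · by_cases hxb : x = b.graphicalRoot
      · exact ⟨a.graphicalRoot, by simp [hxb]⟩
      · obtain ⟨i, hi⟩ := hb x hx hxb
        exact ⟨i, by simp [hi]⟩

theorem root_eq_of_arcs_eq {m m' : BracketMonomial X} (hm : m.letters.Nodup)
    (hl : m.letters.Perm m'.letters) (h : m.arcs = m'.arcs) :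
    m.graphicalRoot = m'.graphicalRoot := by
  by_contra hne
  obtain ⟨i, hi⟩ := exists_mem_arcs (hl.nodup hm) _ (hl.subset m.graphicalRoot_mem) hne
  exact not_mem_arcs_root hm i (h ▸ hi)

theorem card_arcs_lt (m : BracketMonomial X) : m.arcs.card < m.letters.length := by
  induction m with
  | letter x => simp [arcs, letters]
  | br c a b iha ihb =>
    rw [arcs, letters, List.length_append]
    refine (Finset.card_insert_le _ _).trans_lt ?_
    have := Finset.card_union_le a.arcs b.arcs
    omega

/-- The tree of the losing factor hangs from the winning root, so its depths are shifted by one. -/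
theorem exists_depth {m : BracketMonomial X} (hm : m.letters.Nodup) :
    ∃ D : X → ℕ, D m.graphicalRoot = 0 ∧ ∀ i j, (i, j) ∈ m.arcs → D j = D i + 1 := by
  classical
  induction m, hm using nodup_induction with
  | hl x _ => exact ⟨0, by simp [arcs]⟩
  | hs c a b _ _ h => rwa [arcs_comm, graphicalRoot_comm]
  | hbr c a b hm hw ha hb =>
    obtain ⟨Da, ha0, ha⟩ := ha
    obtain ⟨Db, hb0, hb⟩ := hb
    have hd := (nodup_br.1 hm).2.2
    refine ⟨fun x => if x ∈ a.letters then Da x else Db x + 1, ?_, fun i j hij => ?_⟩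
    · simp [hw.root, a.graphicalRoot_mem, ha0]
    · rw [hw.arcs, Finset.mem_insert, Finset.mem_union, Prod.mk.injEq] at hij
      rcases hij with ⟨rfl, rfl⟩ | h | h
      · have : b.graphicalRoot ∉ a.letters := fun h => hd h b.graphicalRoot_mem
        simp [a.graphicalRoot_mem, this, ha0, hb0]
      · simp [mem_of_mem_arcs h, ha i j h]
      · have h1 : i ∉ a.letters := fun h' => hd h' (mem_of_mem_arcs h).1
        have h2 : j ∉ a.letters := fun h' => hd h' (mem_of_mem_arcs h).2
        simp [h1, h2, hb i j h]

/-- `T` contains, for every product `br c a b` in the monomial, an arc of colour `c` from a letter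
of one factor to the root of the restriction of `T` to the other factor; the vertex is the root of
the restriction of `T` to the letters of the monomial. -/
inductive Compat (T : Finset (X × X)) : BracketMonomial X → X → Prop
  | letter (x : X) : Compat T (letter x) x
  | left {c : BracketColor} {a b : BracketMonomial X} {r s i : X} (ha : Compat T a r)
      (hb : Compat T b s) (hi : i ∈ a.letters) (hT : (i, s) ∈ T) (hc : arcColor i s = c) :
      Compat T (br c a b) r
  | right {c : BracketColor} {a b : BracketMonomial X} {r s i : X} (ha : Compat T a r)
      (hb : Compat T b s) (hi : i ∈ b.letters) (hT : (i, r) ∈ T) (hc : arcColor i r = c) :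
      Compat T (br c a b) s

theorem Compat.swap {T : Finset (X × X)} {c : BracketColor} {a b : BracketMonomial X} {r : X}
    (h : Compat T (br c a b) r) : Compat T (br c b a) r := by
  cases h with
  | left ha hb hi hT hc => exact .right hb ha hi hT hc
  | right ha hb hi hT hc => exact .left hb ha hi hT hc

theorem Compat.mono {T T' : Finset (X × X)} (hT : T ⊆ T') {m : BracketMonomial X} {r : X}
    (h : Compat T m r) : Compat T' m r := by
  induction h with
  | letter x => exact .letter x
  | left _ _ hi h hc iha ihb => exact .left iha ihb hi (hT h) hc
  | right _ _ hi h hc iha ihb => exact .right iha ihb hi (hT h) hc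

theorem Compat.root_mem {T : Finset (X × X)} {m : BracketMonomial X} {r : X}
    (h : Compat T m r) : r ∈ m.letters := by
  induction h with
  | letter x => simp [letters]
  | left _ _ hi h hc iha ihb => simp [letters, iha]
  | right _ _ hi h hc iha ihb => simp [letters, ihb]

/-- All letters but `r` have a parent inside the monomial. With indegree at most one, an arc from
outside can then enter only at `r`. -/
theorem Compat.exists_arc {T : Finset (X × X)} {m : BracketMonomial X} {r : X}
    (h : Compat T m r) : ∀ x ∈ m.letters, x ≠ r → ∃ i ∈ m.letters, (i, x) ∈ T := by
  induction h with
  | letter x => simp [letters]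
  | @left c a b r s i ha hb hi h hc iha ihb =>
    intro x hx hxr
    simp only [mem_letters_br] at hx ⊢
    rcases hx with hx | hx
    · obtain ⟨k, hk, hk'⟩ := iha x hx hxr
      exact ⟨k, .inl hk, hk'⟩
    · by_cases hxs : x = s
      · exact ⟨i, .inl hi, hxs ▸ h⟩
      · obtain ⟨k, hk, hk'⟩ := ihb x hx hxs
        exact ⟨k, .inr hk, hk'⟩
  | @right c a b r s i ha hb hi h hc iha ihb =>
    intro x hx hxr
    simp only [mem_letters_br] at hx ⊢
    rcases hx with hx | hx
    · by_cases hxs : x = r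
      · exact ⟨i, .inr hi, hxs ▸ h⟩
      · obtain ⟨k, hk, hk'⟩ := iha x hx hxs
        exact ⟨k, .inl hk, hk'⟩
    · obtain ⟨k, hk, hk'⟩ := ihb x hx hxr
      exact ⟨k, .inr hk, hk'⟩

theorem compat_arcs {m : BracketMonomial X} (hm : m.letters.Nodup) :
    Compat m.arcs m m.graphicalRoot := by
  induction m, hm using nodup_induction with
  | hl x _ => exact .letter x
  | hs c a b _ _ h => rw [arcs_comm, graphicalRoot_comm]; exact h.swap
  | hbr c a b hm hw ha hb =>
    rw [hw.root, hw.arcs]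
    refine .left (ha.mono fun x hx => ?_) (hb.mono fun x hx => ?_) a.graphicalRoot_mem
      (by simp) hw.color <;> simp [hx]

end Arcs

end BracketMonomial

/-! ### The order on trees: a monomial's own tree is the largest compatible one. -/

namespace BracketMonomial

section Order

variable {X : Type*} [LinearOrder X]

/-- The total weight of the arcs with head `x`, where an arc of colour `c` has weight `w c x`. -/
def inWeight (w : BracketColor → X → ℤ) (T : Finset (X × X)) (x : X) : ℤ :=
  ∑ e ∈ T with e.2 = x, w (arcColor e.1 x) x

theorem inWeight_eq (w : BracketColor → X → ℤ) {T : Finset (X × X)} (hT : IndegreeLeOne T)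
    {i x : X} (h : (i, x) ∈ T) : inWeight w T x = w (arcColor i x) x := by
  have : T.filter (fun e => e.2 = x) = {(i, x)} := by
    ext ⟨j, y⟩
    simp only [Finset.mem_filter, Finset.mem_singleton, Prod.mk.injEq]
    constructor
    · rintro ⟨h1, rfl⟩
      exact ⟨hT h1 h, rfl⟩
    · rintro ⟨rfl, rfl⟩
      exact ⟨h, rfl⟩
  simp [inWeight, this]

theorem inWeight_eq_zero (w : BracketColor → X → ℤ) {T : Finset (X × X)}
    {x : X} (h : ∀ i, (i, x) ∉ T) : inWeight w T x = 0 := by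
  refine Finset.sum_eq_zero fun e he => ?_
  rw [Finset.mem_filter] at he
  obtain ⟨h1, rfl⟩ := he
  exact (h e.1 h1).elim

/-- The signed value of a child, with the sign of the colour of the arc to its parent. -/
def signedValue (f : X → ℤ) (c : BracketColor) (x : X) : ℤ := c.sign * f x

/-- The total signed value of the children in the subtree of a monomial with root `r`. -/
def childValue (f : X → ℤ) (T : Finset (X × X)) (m : BracketMonomial X) (r : X) : ℤ :=
  (m.letters.map (inWeight (signedValue f) T)).sum - inWeight (signedValue f) T r

theorem childValue_left (f : X → ℤ) (T : Finset (X × X)) (c : BracketColor)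
    (a b : BracketMonomial X) (r s : X) :
    childValue f T (br c a b) r =
      childValue f T a r + childValue f T b s + inWeight (signedValue f) T s := by
  simp only [childValue, letters, List.map_append, List.sum_append]
  ring

theorem childValue_swap (f : X → ℤ) (T : Finset (X × X)) (c : BracketColor)
    (a b : BracketMonomial X) (r : X) :
    childValue f T (br c a b) r = childValue f T (br c b a) r := by
  simp only [childValue, letters, List.map_append, List.sum_append]
  ring

/-- Bounding the gap below by the distance between the two roots, rather than by zero, is what lets
the induction pass: replacing the child `b.graphicalRoot` by another vertex `s` changes the sum by
at most `|f s - f b.graphicalRoot|`, which the gap of `b` pays for. -/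
theorem abs_sub_le_childValue_sub {f : X → ℤ} (hf : StrictMono f) {T T₀ : Finset (X × X)}
    (hT : IndegreeLeOne T) (hT₀ : IndegreeLeOne T₀) {m : BracketMonomial X}
    (hm : m.letters.Nodup) : m.arcs ⊆ T₀ → ∀ r, Compat T m r →
      |f r - f m.graphicalRoot| ≤
        childValue f T₀ m m.graphicalRoot - childValue f T m r := by
  induction m, hm using nodup_induction with
  | hl x _ =>
    intro _ r hr
    cases hr
    simp [childValue, letters, graphicalRoot]
  | hs c a b _ _ h =>
    intro h0 r hr
    rw [arcs_comm] at h0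
    rw [childValue_swap f T, childValue_swap f T₀, graphicalRoot_comm]
    exact h h0 r hr.swap
  | hbr c a b hm hw ha hb =>
    intro h0 r hr
    rw [hw.arcs, Finset.insert_subset_iff, Finset.union_subset_iff] at h0
    obtain ⟨h01, h02, h03⟩ := h0
    rw [hw.root, childValue_left f T₀ _ _ _ _ b.graphicalRoot, inWeight_eq _ hT₀ h01, hw.color]
    have hlt := sign_mul_lt hf hw.ne
    rw [hw.color] at hlt
    cases hr with
    | @left _ _ _ _ s i har hbs hi hiT hc =>
      have h1 := ha h02 _ har
      have h2 := hb h03 _ hbs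
      rw [childValue_left f T _ _ _ _ s, inWeight_eq _ hT hiT, hc, signedValue, signedValue]
      have h3 := le_abs_self (c.sign * (f s - f b.graphicalRoot))
      rw [c.abs_sign_mul, mul_sub] at h3
      linarith
    | @right _ _ _ s _ i has hbr hi hiT hc =>
      have h1 := ha h02 _ has
      have h2 := hb h03 _ hbr
      rw [childValue_swap, childValue_left f T _ _ _ _ s, inWeight_eq _ hT hiT, hc, signedValue,
        signedValue]
      have h3 := le_abs_self (c.sign * (f s - f a.graphicalRoot))
      rw [c.abs_sign_mul, mul_sub] at h3
      -- Here the root of `T` lies in `b`. Making `a` rather than `b` the child costs exactly the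
      -- distance of the two graphical roots, because `a` wins the product.
      have h4 : |f r - f a.graphicalRoot| ≤
          |f r - f b.graphicalRoot| + |f b.graphicalRoot - f a.graphicalRoot| :=
        abs_sub_le _ _ _
      have h5 : |f b.graphicalRoot - f a.graphicalRoot| =
          c.sign * f b.graphicalRoot - c.sign * f a.graphicalRoot := by
        rw [← c.abs_sign_mul, mul_sub, abs_of_pos (by linarith)]
      linarith

/-- `D` increases by one along every arc. -/
def IsDepth {X : Type*} (T : Finset (X × X)) (D : X → ℕ) : Prop :=
  ∀ i j, (i, j) ∈ T → D j = D i + 1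

/-- A factor that does not contain the root is entered by an arc from the other factor, so its own
root is strictly deeper than `r`. -/
theorem Compat.depth_le {T : Finset (X × X)} {D : X → ℕ} (hD : IsDepth T D)
    {m : BracketMonomial X} {r : X} (h : Compat T m r) :
    ∀ x ∈ m.letters, D r ≤ D x ∧ (D x = D r → x = r) := by
  induction h with
  | letter x => simp [letters]
  | @left c a b r s i ha hb hi h hc iha ihb =>
    intro x hx
    rcases mem_letters_br.1 hx with hx | hx
    · exact iha x hx
    · have h1 := ihb x hx
      have h2 := iha i hi
      have h3 := hD i s h
      exact ⟨by omega, by omega⟩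
  | @right c a b r s i ha hb hi h hc iha ihb =>
    intro x hx
    rcases mem_letters_br.1 hx with hx | hx
    · have h1 := iha x hx
      have h2 := ihb i hi
      have h3 := hD i r h
      exact ⟨by omega, by omega⟩
    · exact ihb x hx

/-- The sequence with the weight `K - signedValue` of `x` at the depth of `x`. -/
def levelWeight (f : X → ℤ) (K : ℤ) (T : Finset (X × X)) (D : X → ℕ) (x : X) : Lex (ℕ → ℤ) :=
  toLex (Pi.single (D x) (inWeight (fun c y => K - signedValue f c y) T x))

/-- The sequence of the total weights of the letters at each depth. -/
def levelSum (f : X → ℤ) (K : ℤ) (T : Finset (X × X)) (D : X → ℕ) (m : BracketMonomial X) :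
    Lex (ℕ → ℤ) :=
  (m.letters.map (levelWeight f K T D)).sum

theorem levelSum_br (f : X → ℤ) (K : ℤ) (T : Finset (X × X)) (D : X → ℕ) (c : BracketColor)
    (a b : BracketMonomial X) :
    levelSum f K T D (br c a b) = levelSum f K T D a + levelSum f K T D b := by
  simp [levelSum, letters]

theorem levelSum_apply (f : X → ℤ) (K : ℤ) (T : Finset (X × X)) (D : X → ℕ)
    (m : BracketMonomial X) (n : ℕ) :
    levelSum f K T D m n =
      (m.letters.map (fun x => levelWeight f K T D x n)).sum := by
  induction m with
  | letter x => simp [levelSum, letters]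
  | br c a b iha ihb =>
    rw [levelSum_br]
    simp only [letters, List.map_append, List.sum_append, ← iha, ← ihb]
    rfl

theorem levelWeight_apply (f : X → ℤ) (K : ℤ) (T : Finset (X × X)) (D : X → ℕ) (x : X) (n : ℕ) :
    levelWeight f K T D x n =
      if n = D x then inWeight (fun c y => K - signedValue f c y) T x else 0 := by
  simp [levelWeight, Pi.single_apply]

theorem levelSum_of_lt {f : X → ℤ} {K : ℤ} {T : Finset (X × X)} {D : X → ℕ} (hD : IsDepth T D)
    {m : BracketMonomial X} {r : X} (h : Compat T m r) {n : ℕ} (hn : n < D r) :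
    levelSum f K T D m n = 0 := by
  rw [levelSum_apply]
  refine List.sum_eq_zero fun z hz => ?_
  obtain ⟨x, hx, rfl⟩ := List.mem_map.1 hz
  have := h.depth_le hD x hx
  rw [levelWeight_apply, if_neg (by omega)]

theorem levelSum_root {f : X → ℤ} {K : ℤ} {T : Finset (X × X)} {D : X → ℕ} (hD : IsDepth T D)
    {m : BracketMonomial X} (hm : m.letters.Nodup) {r : X} (h : Compat T m r) :
    levelSum f K T D m (D r) = inWeight (fun c y => K - signedValue f c y) T r := by
  rw [levelSum_apply, ← List.sum_toFinset _ hm, Finset.sum_eq_single r]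
  · simp [levelWeight_apply]
  · intro x hx hxr
    rw [List.mem_toFinset] at hx
    rw [levelWeight_apply, if_neg fun h' => hxr ((h.depth_le hD x hx).2 h'.symm)]
  · simp [h.root_mem]

theorem Lex.lt_of_apply_lt {u v : Lex (ℕ → ℤ)} (n : ℕ) (h : ∀ k < n, u k = v k)
    (hn : u n < v n) : u < v :=
  ⟨n, h, hn⟩

/-- This treats the equality case of `abs_sub_le_childValue_sub`. The weight of the root is removed
because the arc entering it comes from outside the monomial. -/
theorem levelSum_sub_lt_or_eq {f : X → ℤ} (hf : StrictMono f) {K : ℤ} (hK : ∀ x, |f x| < K)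
    {T T₀ : Finset (X × X)} {D D₀ : X → ℕ} (hT : IndegreeLeOne T) (hT₀ : IndegreeLeOne T₀)
    (hD : IsDepth T D) (hD₀ : IsDepth T₀ D₀) {m : BracketMonomial X} (hm : m.letters.Nodup) :
    m.arcs ⊆ T₀ → Compat T m m.graphicalRoot →
      childValue f T m m.graphicalRoot = childValue f T₀ m m.graphicalRoot →
      D m.graphicalRoot = D₀ m.graphicalRoot →
      levelSum f K T D m - levelWeight f K T D m.graphicalRoot <
          levelSum f K T₀ D₀ m - levelWeight f K T₀ D₀ m.graphicalRoot ∨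
        levelSum f K T D m - levelWeight f K T D m.graphicalRoot =
          levelSum f K T₀ D₀ m - levelWeight f K T₀ D₀ m.graphicalRoot ∧ m.arcs ⊆ T := by
  induction m, hm using nodup_induction with
  | hl x _ => simp [levelSum, arcs, letters, graphicalRoot]
  | hs c a b _ _ h =>
    rw [arcs_comm, graphicalRoot_comm, childValue_swap f T, childValue_swap f T₀,
      levelSum_br, levelSum_br, add_comm, add_comm (levelSum f K T₀ D₀ a), ← levelSum_br f K T D c,
      ← levelSum_br f K T₀ D₀ c]
    exact fun h1 h2 => h h1 h2.swap
  | hbr c a b hm hw ha hb =>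
    intro h0 hr hv hroot
    obtain ⟨hna, hnb, hd⟩ := nodup_br.1 hm
    rw [hw.arcs, Finset.insert_subset_iff, Finset.union_subset_iff] at h0
    obtain ⟨h01, h02, h03⟩ := h0
    rw [hw.root] at hr hv hroot ⊢
    rw [childValue_left f T₀ _ _ _ _ b.graphicalRoot, inWeight_eq _ hT₀ h01, hw.color] at hv
    have hlt := sign_mul_lt hf hw.ne
    rw [hw.color] at hlt
    generalize hrr : a.graphicalRoot = r at hr
    cases hr with
    | @right _ _ _ s _ i has hbr hi hiT hc =>
      exact (hd a.graphicalRoot_mem (hrr ▸ hbr.root_mem)).elim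
    | @left _ _ _ _ s i har hbs hi hiT hc =>
      rw [← hrr] at har ⊢
      have h1 := abs_sub_le_childValue_sub hf hT hT₀ hna h02 _ har
      have h2 := abs_sub_le_childValue_sub hf hT hT₀ hnb h03 _ hbs
      rw [childValue_left f T _ _ _ _ s, inWeight_eq _ hT hiT, hc, signedValue, signedValue] at hv
      have h3 := le_abs_self (c.sign * (f s - f b.graphicalRoot))
      rw [c.abs_sign_mul, mul_sub] at h3
      rw [sub_self, abs_zero] at h1
      have hva : childValue f T a a.graphicalRoot = childValue f T₀ a a.graphicalRoot := by
        linarith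
      -- Equality of the child values forces the gap of `b` to equal this difference, so it is
      -- nonnegative.
      have hsb : 0 ≤ c.sign * f s - c.sign * f b.graphicalRoot := by
        linarith [abs_nonneg (f s - f b.graphicalRoot)]
      have hA := ha h02 har hva hroot
      have hDi := (har.depth_le hD i hi)
      have hDs := hD _ _ hiT
      have hD₀b := hD₀ _ _ h01
      have hcb : Compat T₀ b b.graphicalRoot := (compat_arcs hnb).mono h03
      have hws : inWeight (fun c y => K - signedValue f c y) T s = K - c.sign * f s := by
        rw [inWeight_eq _ hT hiT, hc, signedValue]
      have hwb : inWeight (fun c y => K - signedValue f c y) T₀ b.graphicalRoot =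
          K - c.sign * f b.graphicalRoot := by
        rw [inWeight_eq _ hT₀ h01, hw.color, signedValue]
      have key : levelSum f K T D b < levelSum f K T₀ D₀ b ∨
          levelSum f K T D b = levelSum f K T₀ D₀ b ∧ b.arcs ⊆ T ∧
            (a.graphicalRoot, b.graphicalRoot) ∈ T := by
        by_cases hia : D i = D a.graphicalRoot
        · obtain rfl := hDi.2 hia
          have hDD : D s = D₀ b.graphicalRoot := by omega
          by_cases hsr : s = b.graphicalRoot
          · subst hsr
            have hvb : childValue f T b b.graphicalRoot = childValue f T₀ b b.graphicalRoot := by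
              linarith
            have hlw : levelWeight f K T D b.graphicalRoot =
                levelWeight f K T₀ D₀ b.graphicalRoot := by
              rw [levelWeight, levelWeight, hws, hwb, hDD]
            rcases hb h03 hbs hvb hDD with h | ⟨h, h'⟩
            · left
              rw [hlw] at h
              exact (sub_lt_sub_iff_right _).1 h
            · right
              rw [hlw] at h
              exact ⟨sub_left_injective h, h', hiT⟩
          -- A different child at the same depth has a strictly larger signed value, hence a smaller
          -- weight at the first level that `b` occupies.
          · left
            have hne : f s ≠ f b.graphicalRoot := hf.injective.ne hsr
            have hne' : c.sign * f s - c.sign * f b.graphicalRoot ≠ 0 := by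
              rw [← mul_sub]
              refine mul_ne_zero ?_ (sub_ne_zero.2 hne)
              cases c <;> simp [BracketColor.sign]
            refine Lex.lt_of_apply_lt (D s) (fun k hk => ?_) ?_
            · rw [levelSum_of_lt hD hbs hk, levelSum_of_lt hD₀ hcb (hDD ▸ hk)]
            · rw [levelSum_root hD hnb hbs, hDD, levelSum_root hD₀ hnb hcb, hws, hwb]
              have := lt_of_le_of_ne hsb hne'.symm
              linarith
        -- The arc of `T` starts below the root of `a`, so `T` has nothing of `b` at the level where
        -- `T₀` already has the positive weight of `b.graphicalRoot`; positivity is the role of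
        -- `hK`.
        · left
          have hlt' : D₀ b.graphicalRoot < D s := by omega
          refine Lex.lt_of_apply_lt (D₀ b.graphicalRoot) (fun k hk => ?_) ?_
          · rw [levelSum_of_lt hD hbs (hk.trans hlt'), levelSum_of_lt hD₀ hcb hk]
          · rw [levelSum_of_lt hD hbs hlt', levelSum_root hD₀ hnb hcb, hwb]
            have := le_abs_self (c.sign * f b.graphicalRoot)
            rw [c.abs_sign_mul] at this
            linarith [hK b.graphicalRoot]
      rw [levelSum_br, levelSum_br, add_sub_right_comm, add_sub_right_comm]
      rw [hw.arcs, Finset.insert_subset_iff, Finset.union_subset_iff]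
      rcases hA with hA | ⟨hA, hA'⟩ <;> rcases key with hB | ⟨hB, hB', hB''⟩
      · exact .inl (add_lt_add hA hB)
      · exact .inl (by rw [hB]; exact (add_lt_add_iff_right _).2 hA)
      · exact .inl (by rw [hA]; exact (add_lt_add_iff_left _).2 hB)
      · exact .inr ⟨by rw [hA, hB], hB'', hA', hB'⟩

open Classical in
/-- A depth function that is zero at the root, if there is one. -/
noncomputable def depth {X : Type*} (T : Finset (X × X)) : X → ℕ :=
  if h : ∃ D, IsDepth T D ∧ ∀ r, (∀ i, (i, r) ∉ T) → D r = 0 then h.choose else 0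

theorem depth_spec {X : Type*} {T : Finset (X × X)}
    (h : ∃ D, IsDepth T D ∧ ∀ r, (∀ i, (i, r) ∉ T) → D r = 0) :
    IsDepth T (depth T) ∧ ∀ r, (∀ i, (i, r) ∉ T) → depth T r = 0 := by
  rw [depth, dif_pos h]
  exact h.choose_spec

theorem IsMultilinear.nodup {m : BracketMonomial X} (hm : m.IsMultilinear) : m.letters.Nodup :=
  List.nodup_iff_count_le_one.2 fun x => (hm x).le

theorem IsMultilinear.mem {m : BracketMonomial X} (hm : m.IsMultilinear) (x : X) :
    x ∈ m.letters :=
  List.count_pos_iff.1 (by rw [hm x]; exact one_pos)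

theorem IsMultilinear.depth_spec {m : BracketMonomial X} (hm : m.IsMultilinear) :
    IsDepth m.arcs (depth m.arcs) ∧ depth m.arcs m.graphicalRoot = 0 := by
  obtain ⟨D, h0, hD⟩ := exists_depth hm.nodup
  have := BracketMonomial.depth_spec (T := m.arcs) ⟨D, hD, fun r hr => by
    by_contra hne
    obtain ⟨i, hi⟩ := exists_mem_arcs hm.nodup r (hm.mem r) (fun h => hne (h ▸ h0))
    exact hr i hi⟩
  exact ⟨this.1, this.2 _ (not_mem_arcs_root hm.nodup)⟩

section Key

variable [Fintype X]

/-- An order preserving embedding of a finite linear order in the integers. -/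
def rank (x : X) : ℤ := (Finset.univ.filter (· < x)).card

theorem rank_strictMono : StrictMono (rank : X → ℤ) := fun x y h => by
  refine Nat.cast_lt.2 (Finset.card_lt_card ⟨fun z hz => ?_, fun h' => ?_⟩)
  · simp only [Finset.mem_filter, Finset.mem_univ, true_and] at hz ⊢
    exact hz.trans h
  · simpa using h' (by simpa using h : x ∈ Finset.univ.filter (· < y))

theorem abs_rank_lt (x : X) : |rank x| < Fintype.card X + 1 := by
  rw [rank, Nat.abs_cast]
  have := Finset.card_le_univ (Finset.univ.filter (· < x))
  omega

/-- The key by which the trees of monomials are ordered. -/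
noncomputable def treeKey (T : Finset (X × X)) : ℤ ×ₗ Lex (ℕ → ℤ) :=
  toLex (∑ x, inWeight (signedValue rank) T x,
    ∑ x, levelWeight rank (Fintype.card X + 1) T (depth T) x)

theorem IsMultilinear.sum_letters {m : BracketMonomial X} (hm : m.IsMultilinear)
    {M : Type*} [AddCommMonoid M] (g : X → M) : (m.letters.map g).sum = ∑ x, g x := by
  rw [← List.sum_toFinset _ hm.nodup]
  congr 1
  ext x
  simp [hm.mem x]

theorem arcs_eq_or_treeKey_lt {m m' : BracketMonomial X} (hm : m.IsMultilinear)
    (hm' : m'.IsMultilinear) {r : X} (h : Compat m'.arcs m r) :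
    m'.arcs = m.arcs ∨ treeKey m'.arcs < treeKey m.arcs := by
  have hT := indegreeLeOne_arcs hm'.nodup
  have hT₀ := indegreeLeOne_arcs hm.nodup
  have hr : r = m'.graphicalRoot := by
    by_contra hne
    obtain ⟨i, -, hi⟩ := h.exists_arc _ (hm.mem m'.graphicalRoot) (Ne.symm hne)
    exact not_mem_arcs_root hm'.nodup i hi
  subst hr
  have h1 := abs_sub_le_childValue_sub rank_strictMono hT hT₀ hm.nodup subset_rfl _ h
  have e1 : childValue rank m'.arcs m m'.graphicalRoot =
      ∑ x, inWeight (signedValue rank) m'.arcs x := by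
    rw [childValue, hm.sum_letters, inWeight_eq_zero _ (not_mem_arcs_root hm'.nodup), sub_zero]
  have e2 : childValue rank m.arcs m m.graphicalRoot =
      ∑ x, inWeight (signedValue rank) m.arcs x := by
    rw [childValue, hm.sum_letters, inWeight_eq_zero _ (not_mem_arcs_root hm.nodup), sub_zero]
  rcases lt_or_eq_of_le (sub_nonneg.1 ((abs_nonneg _).trans h1)) with hlt | heq
  · right
    rw [e1, e2] at hlt
    exact Prod.Lex.toLex_lt_toLex.2 (.inl hlt)
  · rw [heq, sub_self] at h1
    have hroot : m'.graphicalRoot = m.graphicalRoot :=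
      rank_strictMono.injective (sub_eq_zero.1 (abs_nonpos_iff.1 h1))
    have z1 : levelWeight rank (Fintype.card X + 1) m'.arcs (depth m'.arcs) m.graphicalRoot
        = 0 := by
      rw [levelWeight, ← hroot, inWeight_eq_zero _ (not_mem_arcs_root hm'.nodup)]
      simp
    have z2 : levelWeight rank (Fintype.card X + 1) m.arcs (depth m.arcs) m.graphicalRoot
        = 0 := by
      rw [levelWeight, inWeight_eq_zero _ (not_mem_arcs_root hm.nodup)]
      simp
    have h2 := levelSum_sub_lt_or_eq rank_strictMono abs_rank_lt hT hT₀ hm'.depth_spec.1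
      hm.depth_spec.1 hm.nodup subset_rfl (hroot ▸ h) (by rw [← heq, hroot])
      (by rw [hm.depth_spec.2, ← hroot, hm'.depth_spec.2])
    rw [z1, z2, sub_zero, sub_zero, levelSum, levelSum, hm.sum_letters, hm.sum_letters] at h2
    rcases h2 with h2 | ⟨-, h2⟩
    · right
      rw [e1, e2] at heq
      exact Prod.Lex.toLex_lt_toLex.2 (.inr ⟨heq, h2⟩)
    · left
      -- Inclusion of `m.arcs` suffices: every vertex except the root already has its parent in `m`,
      -- and `m'.arcs` allows no second one.
      refine Finset.Subset.antisymm (fun ⟨i, x⟩ hix => ?_) h2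
      have hx : x ≠ m.graphicalRoot := fun h' =>
        not_mem_arcs_root hm'.nodup i (by rw [hroot, ← h']; exact hix)
      obtain ⟨k, hk⟩ := exists_mem_arcs hm.nodup x (hm.mem x) hx
      rwa [hT hix (h2 hk)]

end Key

end Order

end BracketMonomial

/-! ### Compatible Lie brackets on the free module on multisets. -/

section TorusModel

variable (R : Type*) [CommRing R] {X : Type*}

/-- The extension of a matrix `w` to a biadditive form on multisets. -/
def multisetForm {R : Type*} [CommRing R] (w : X → X → R) (s t : Multiset X) : R :=
  (s.map fun i => (t.map fun j => w i j).sum).sum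

theorem multisetForm_add_left {R : Type*} [CommRing R] (w : X → X → R) (s s' t : Multiset X) :
    multisetForm w (s + s') t = multisetForm w s t + multisetForm w s' t := by
  simp [multisetForm]

theorem multisetForm_add_right {R : Type*} [CommRing R] (w : X → X → R) (s t t' : Multiset X) :
    multisetForm w s (t + t') = multisetForm w s t + multisetForm w s t' := by
  simp [multisetForm, Multiset.sum_map_add]

theorem multisetForm_swap {R : Type*} [CommRing R] {w : X → X → R} (hw : ∀ i j, w j i = -w i j)
    (s t : Multiset X) : multisetForm w t s = -multisetForm w s t := by
  induction s using Multiset.induction_on with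
  | empty => simp [multisetForm]
  | cons x s ih =>
    rw [← Multiset.singleton_add, multisetForm_add_left, multisetForm_add_right, ih, neg_add]
    congr 1
    simp only [multisetForm, Multiset.map_singleton, Multiset.sum_singleton]
    simp only [hw x]
    exact Multiset.sum_map_neg

/-- The bracket `(u^s, u^t) ↦ w(s, t) u^(s + t)` on the free module on multisets. -/
noncomputable def torusBracket (w : X → X → R) :
    (Multiset X →₀ R) →ₗ[R] (Multiset X →₀ R) →ₗ[R] (Multiset X →₀ R) :=
  Finsupp.linearCombination R fun s =>
    Finsupp.linearCombination R fun t => Finsupp.single (s + t) (multisetForm w s t)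

variable {R}

theorem torusBracket_single (w : X → X → R) (s t : Multiset X) (p q : R) :
    torusBracket R w (Finsupp.single s p) (Finsupp.single t q) =
      Finsupp.single (s + t) (p * q * multisetForm w s t) := by
  simp only [torusBracket, Finsupp.linearCombination_single, LinearMap.smul_apply,
    Finsupp.smul_single, smul_eq_mul, mul_assoc]

theorem torusBracket_antisymm {w : X → X → R} (hw : ∀ i j, w j i = -w i j)
    (x y : Multiset X →₀ R) : torusBracket R w x y + torusBracket R w y x = 0 := by
  induction x using Finsupp.induction_linear with
  | zero => simp
  | add x x' hx hx' =>
    simp only [map_add, LinearMap.add_apply]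
    rw [add_add_add_comm, hx, hx', add_zero]
  | single s p =>
    induction y using Finsupp.induction_linear with
    | zero => simp
    | add y y' hy hy' =>
      simp only [map_add, LinearMap.add_apply]
      rw [add_add_add_comm, hy, hy', add_zero]
    | single t q =>
      rw [torusBracket_single, torusBracket_single, multisetForm_swap hw s t, add_comm t s,
        ← Finsupp.single_add]
      rw [Finsupp.single_eq_zero]
      ring

/-- On basis elements all six terms are multiples of one basis element, and biadditivity and
antisymmetry make the coefficients cancel. -/
theorem torusBracket_mixed_jacobi {w w' : X → X → R} (hw : ∀ i j, w j i = -w i j)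
    (hw' : ∀ i j, w' j i = -w' i j) (x y z : Multiset X →₀ R) :
    torusBracket R w x (torusBracket R w' y z) + torusBracket R w y (torusBracket R w' z x)
      + torusBracket R w z (torusBracket R w' x y) + torusBracket R w' x (torusBracket R w y z)
      + torusBracket R w' y (torusBracket R w z x)
      + torusBracket R w' z (torusBracket R w x y) = 0 := by
  induction x using Finsupp.induction_linear with
  | zero => simp
  | add x x' hx hx' =>
    rw [← add_zero 0]
    nth_rw 1 [← hx]
    rw [← hx']
    simp only [map_add, LinearMap.add_apply]
    abel
  | single s p =>
    induction y using Finsupp.induction_linear with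
    | zero => simp
    | add x x' hx hx' =>
      rw [← add_zero 0]
      nth_rw 1 [← hx]
      rw [← hx']
      simp only [map_add, LinearMap.add_apply]
      abel
    | single t q =>
      induction z using Finsupp.induction_linear with
      | zero => simp
      | add x x' hx hx' =>
        rw [← add_zero 0]
        nth_rw 1 [← hx]
        rw [← hx']
        simp only [map_add, LinearMap.add_apply]
        abel
      | single u r =>
        have e1 : t + (u + s) = s + (t + u) := by abel
        have e2 : u + (s + t) = s + (t + u) := by abel
        simp only [torusBracket_single, e1, e2, ← Finsupp.single_add]
        rw [Finsupp.single_eq_zero]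
        simp only [multisetForm_add_right]
        rw [multisetForm_swap hw s t, multisetForm_swap hw' s t, multisetForm_swap hw t u,
          multisetForm_swap hw' t u, multisetForm_swap hw s u, multisetForm_swap hw' s u]
        ring

/-- The mixed identity with `w = w'` gives only twice this one, which is too weak when 2 is not
cancellable in `R`. -/
theorem torusBracket_jacobi {w : X → X → R} (hw : ∀ i j, w j i = -w i j)
    (x y z : Multiset X →₀ R) :
    torusBracket R w x (torusBracket R w y z) + torusBracket R w y (torusBracket R w z x)
      + torusBracket R w z (torusBracket R w x y) = 0 := by
  induction x using Finsupp.induction_linear with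
  | zero => simp
  | add x x' hx hx' =>
    rw [← add_zero 0]
    nth_rw 1 [← hx]
    rw [← hx']
    simp only [map_add, LinearMap.add_apply]
    abel
  | single s p =>
    induction y using Finsupp.induction_linear with
    | zero => simp
    | add x x' hx hx' =>
      rw [← add_zero 0]
      nth_rw 1 [← hx]
      rw [← hx']
      simp only [map_add, LinearMap.add_apply]
      abel
    | single t q =>
      induction z using Finsupp.induction_linear with
      | zero => simp
      | add x x' hx hx' =>
        rw [← add_zero 0]
        nth_rw 1 [← hx]
        rw [← hx']
        simp only [map_add, LinearMap.add_apply]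
        abel
      | single u r =>
        have e1 : t + (u + s) = s + (t + u) := by abel
        have e2 : u + (s + t) = s + (t + u) := by abel
        simp only [torusBracket_single, e1, e2, ← Finsupp.single_add]
        rw [Finsupp.single_eq_zero]
        simp only [multisetForm_add_right]
        rw [multisetForm_swap hw s t, multisetForm_swap hw t u, multisetForm_swap hw s u]
        ring

/-- The coefficient of the value of a monomial in the torus model. -/
def BracketMonomial.torusCoeff (w : BracketColor → X → X → R) : BracketMonomial X → R
  | .letter _ => 1
  | .br c a b => a.torusCoeff w * b.torusCoeff w * multisetForm (w c) a.letters b.letters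

/-- The evaluation of formal combinations of monomials in the torus model. -/
noncomputable def torusEval (w : BracketColor → X → X → R) :
    FreeTwoBracket R X →ₗ[R] (Multiset X →₀ R) :=
  Finsupp.linearCombination R fun m => Finsupp.single (m.letters : Multiset X) (m.torusCoeff w)

theorem torusEval_single (w : BracketColor → X → X → R) (m : BracketMonomial X) (p : R) :
    torusEval w (Finsupp.single m p) =
      Finsupp.single (m.letters : Multiset X) (p * m.torusCoeff w) := by
  simp [torusEval]

theorem freeTwoBracketOp_single (c : BracketColor) (a b : BracketMonomial X) (p q : R) :
    freeTwoBracketOp R X c (Finsupp.single a p) (Finsupp.single b q) =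
      Finsupp.single (.br c a b) (p * q) := by
  simp [freeTwoBracketOp]

theorem torusEval_op (w : BracketColor → X → X → R) (c : BracketColor)
    (x y : FreeTwoBracket R X) :
    torusEval w (freeTwoBracketOp R X c x y) =
      torusBracket R (w c) (torusEval w x) (torusEval w y) := by
  induction x using Finsupp.induction_linear with
  | zero => simp
  | add x x' hx hx' => simp only [map_add, LinearMap.add_apply, hx, hx']
  | single a p =>
    induction y using Finsupp.induction_linear with
    | zero => simp
    | add x x' hx hx' => simp only [map_add, hx, hx']
    | single b q =>
      rw [freeTwoBracketOp_single, torusEval_single, torusEval_single, torusEval_single,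
        torusBracket_single]
      simp only [BracketMonomial.letters, BracketMonomial.torusCoeff, ← Multiset.coe_add]
      congr 1
      ring

theorem isCompatibleLieIdeal_ker_torusEval {w : BracketColor → X → X → R}
    (hw : ∀ c i j, w c j i = -w c i j) :
    IsCompatibleLieIdeal R X (LinearMap.ker (torusEval w)) where
  op_left_mem c x y hx := by
    rw [LinearMap.mem_ker] at hx ⊢
    simp [torusEval_op, hx]
  op_right_mem c x y hy := by
    rw [LinearMap.mem_ker] at hy ⊢
    simp [torusEval_op, hy]
  antisymm_mem c x y := by
    simp only [LinearMap.mem_ker, map_add, torusEval_op]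
    exact torusBracket_antisymm (hw c) _ _
  jacobi_mem c x y z := by
    simp only [LinearMap.mem_ker, map_add, torusEval_op]
    exact torusBracket_jacobi (hw c) _ _ _
  mixed_jacobi_mem x y z := by
    simp only [LinearMap.mem_ker, map_add, torusEval_op]
    exact torusBracket_mixed_jacobi (hw _) (hw _) _ _ _

theorem BracketMonomial.eval_eq_mkQ (m : BracketMonomial X) :
    m.eval R = (compatibleLieIdeal R X).mkQ (Finsupp.single m 1) := by
  induction m with
  | letter x => rfl
  | br c a b iha ihb =>
    rw [BracketMonomial.eval, iha, ihb, ← mul_one (1 : R), ← freeTwoBracketOp_single, mul_one]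
    rfl

/-- The linear map from the free algebra with two compatible Lie brackets to the torus model. -/
noncomputable def torusLift {w : BracketColor → X → X → R} (hw : ∀ c i j, w c j i = -w c i j) :
    FreeCompatibleLie R X →ₗ[R] (Multiset X →₀ R) :=
  (compatibleLieIdeal R X).liftQ (torusEval w)
    (show compatibleLieIdeal R X ≤ _ from sInf_le (isCompatibleLieIdeal_ker_torusEval hw))

theorem torusLift_eval {w : BracketColor → X → X → R} (hw : ∀ c i j, w c j i = -w c i j)
    (m : BracketMonomial X) :
    torusLift hw (m.eval R) = Finsupp.single (m.letters : Multiset X) (m.torusCoeff w) := by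
  rw [m.eval_eq_mkQ, torusLift, Submodule.mkQ_apply]
  refine (Submodule.liftQ_apply _ _ _).trans ?_
  rw [torusEval_single, one_mul]

end TorusModel

/-! ### The pairing of trees with monomials. -/

namespace BracketMonomial

section Pairing

variable (R : Type*) [CommRing R] {X : Type*} [LinearOrder X]

/-- The signed adjacency matrices of the arcs of either colour. -/
def arcMatrix (T : Finset (X × X)) (c : BracketColor) (i j : X) : R :=
  (if (i, j) ∈ T ∧ arcColor i j = c then 1 else 0) -
    (if (j, i) ∈ T ∧ arcColor j i = c then 1 else 0)

theorem arcMatrix_swap (T : Finset (X × X)) (c : BracketColor) (i j : X) :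
    arcMatrix R T c j i = -arcMatrix R T c i j :=
  (neg_sub _ _).symm

/-- The pairing of trees with monomials. -/
def treePairing (T : Finset (X × X)) (m : BracketMonomial X) : R :=
  m.torusCoeff (arcMatrix R T)

variable {R}

/-- The pairing is a product over the brackets in `m`, so each factor is nonzero and supplies an arc
of the right colour between the two letter sets. -/
theorem exists_compat_of_treePairing_ne_zero {T : Finset (X × X)} (hT : IndegreeLeOne T)
    {m : BracketMonomial X} (hm : m.letters.Nodup) (h : treePairing R T m ≠ 0) :
    ∃ r, Compat T m r := by
  induction m with
  | letter x => exact ⟨x, .letter x⟩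
  | br c a b iha ihb =>
    obtain ⟨hna, hnb, hd⟩ := nodup_br.1 hm
    rw [treePairing, torusCoeff] at h
    obtain ⟨r, hr⟩ := iha hna (left_ne_zero_of_mul (left_ne_zero_of_mul h))
    obtain ⟨s, hs⟩ := ihb hnb (right_ne_zero_of_mul (left_ne_zero_of_mul h))
    have h2 := right_ne_zero_of_mul h
    have : ∃ i ∈ a.letters, ∃ j ∈ b.letters, arcMatrix R T c i j ≠ 0 := by
      by_contra! hcon
      refine h2 (Multiset.sum_eq_zero fun z hz => ?_)
      obtain ⟨i, hi, rfl⟩ := Multiset.mem_map.1 hz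
      refine Multiset.sum_eq_zero fun z hz => ?_
      obtain ⟨j, hj, rfl⟩ := Multiset.mem_map.1 hz
      exact hcon i hi j hj
    obtain ⟨i, hi, j, hj, hij⟩ := this
    have h3 : ((i, j) ∈ T ∧ arcColor i j = c) ∨ ((j, i) ∈ T ∧ arcColor j i = c) := by
      by_contra! hcon
      refine hij ?_
      rw [arcMatrix, if_neg (fun h' => hcon.1 h'.1 h'.2), if_neg (fun h' => hcon.2 h'.1 h'.2),
        sub_zero]
    rcases h3 with ⟨h4, h5⟩ | ⟨h4, h5⟩
    -- Otherwise `j` would have a second parent inside `b`.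
    · have hjs : j = s := by
        by_contra hne
        obtain ⟨k, hk, hk'⟩ := hs.exists_arc j hj hne
        exact hd hi (hT hk' h4 ▸ hk)
      exact ⟨r, .left hr hs hi (hjs ▸ h4) (hjs ▸ h5)⟩
    · have hir : i = r := by
        by_contra hne
        obtain ⟨k, hk, hk'⟩ := hr.exists_arc i hi hne
        exact hd (hT hk' h4 ▸ hk) hj
      exact ⟨s, .right hr hs hj (hir ▸ h4) (hir ▸ h5)⟩

theorem multisetForm_single {w : X → X → R} {s t : List X} (hs : s.Nodup) (ht : t.Nodup) {i j : X}
    (hi : i ∈ s) (hj : j ∈ t) (h : ∀ k ∈ s, ∀ l ∈ t, k ≠ i ∨ l ≠ j → w k l = 0) :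
    multisetForm w s t = w i j := by
  simp only [multisetForm, Multiset.map_coe, Multiset.sum_coe]
  simp only [← List.sum_toFinset _ hs, ← List.sum_toFinset _ ht]
  rw [Finset.sum_eq_single i, Finset.sum_eq_single j]
  · exact fun l hl hlj => h i hi l (List.mem_toFinset.1 hl) (.inr hlj)
  · simp [hj]
  · exact fun k hk hki => Finset.sum_eq_zero fun l hl =>
      h k (List.mem_toFinset.1 hk) l (List.mem_toFinset.1 hl) (.inl hki)
  · simp [hi]

theorem treePairing_swap (T : Finset (X × X)) (c : BracketColor) (a b : BracketMonomial X) :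
    treePairing R T (br c b a) = -treePairing R T (br c a b) := by
  simp only [treePairing, torusCoeff]
  rw [multisetForm_swap (arcMatrix_swap R T c) (a.letters : Multiset X)]
  ring

/-- Only the arc between the two graphical roots joins the factors of a product, so each product
contributes `±1`. -/
theorem isUnit_treePairing {T : Finset (X × X)} {m : BracketMonomial X}
    (hm : m.letters.Nodup) : m.arcs ⊆ T →
      (∀ i ∈ m.letters, ∀ j ∈ m.letters, (i, j) ∈ T → (i, j) ∈ m.arcs) →
      IsUnit (treePairing R T m) := by
  induction m, hm using nodup_induction with
  | hl x _ => simp [treePairing, torusCoeff]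
  | hs c a b _ _ h =>
    rw [arcs_comm, treePairing_swap, IsUnit.neg_iff]
    simpa only [mem_letters_swap] using h
  | hbr c a b hm hw ha hb =>
    intro h1 h2
    obtain ⟨hna, hnb, hd⟩ := nodup_br.1 hm
    have hab := h1
    rw [hw.arcs, Finset.insert_subset_iff, Finset.union_subset_iff] at hab
    simp only [mem_letters_br] at h2
    have hA : IsUnit (treePairing R T a) := ha hab.2.1 fun i hi j hj h =>
      (mem_arcs_left hm).2 ⟨h2 i (.inl hi) j (.inl hj) h, hi, hj⟩
    have hB : IsUnit (treePairing R T b) := hb hab.2.2 fun i hi j hj h =>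
      (mem_arcs_right hm).2 ⟨h2 i (.inr hi) j (.inr hj) h, hi, hj⟩
    have cross : ∀ i ∈ a.letters, ∀ j ∈ b.letters, ((i, j) ∈ T → i = a.graphicalRoot ∧
        j = b.graphicalRoot) ∧ (j, i) ∉ T := by
      intro i hi j hj
      constructor
      · intro h
        have := h2 i (.inl hi) j (.inr hj) h
        rw [hw.arcs, Finset.mem_insert, Finset.mem_union, Prod.mk.injEq] at this
        rcases this with h | h | h
        · exact h
        · exact (hd (mem_of_mem_arcs h).2 hj).elim
        · exact (hd hi (mem_of_mem_arcs h).1).elim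
      · intro h
        have := h2 j (.inr hj) i (.inl hi) h
        rw [hw.arcs, Finset.mem_insert, Finset.mem_union, Prod.mk.injEq] at this
        rcases this with h | h | h
        · exact hd a.graphicalRoot_mem (h.1 ▸ hj)
        · exact hd (mem_of_mem_arcs h).1 hj
        · exact hd hi (mem_of_mem_arcs h).2
    have hW : multisetForm (arcMatrix R T c) a.letters b.letters = 1 := by
      rw [multisetForm_single hna hnb a.graphicalRoot_mem b.graphicalRoot_mem]
      · have := (cross _ a.graphicalRoot_mem _ b.graphicalRoot_mem).2
        rw [arcMatrix, if_pos ⟨hab.1, hw.color⟩, if_neg (fun h => this h.1), sub_zero]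
      · intro k hk l hl hkl
        have := cross k hk l hl
        rw [arcMatrix, if_neg (fun h => ?_), if_neg (fun h => this.2 h.1), sub_zero]
        have := this.1 h.1
        tauto
    rw [treePairing, torusCoeff, hW, mul_one]
    exact hA.mul hB

/-- The pairing with a tree, as a linear functional. -/
noncomputable def treeFunctional (R : Type*) [CommRing R] [Fintype X] (T : Finset (X × X)) :
    FreeCompatibleLie R X →ₗ[R] R :=
  Finsupp.lapply (Finset.univ : Finset X).val ∘ₗ torusLift (arcMatrix_swap R T)

/-- All multilinear monomials have values on the same basis element, the full alphabet, so one
coefficient records them. -/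
theorem treeFunctional_eval [Fintype X] (T : Finset (X × X)) {m : BracketMonomial X}
    (hm : m.IsMultilinear) : treeFunctional R T (m.eval R) = treePairing R T m := by
  have : (m.letters : Multiset X) = (Finset.univ : Finset X).val := by
    refine Multiset.ext.2 fun x => ?_
    rw [Multiset.coe_count, hm x, Multiset.count_eq_one_of_mem Finset.univ.nodup (by simp)]
  rw [treeFunctional, LinearMap.comp_apply, torusLift_eval, this, Finsupp.lapply_apply,
    Finsupp.single_eq_same, treePairing]

end Pairing

end BracketMonomial

/-! ### Identities in the free algebra, in the form of exchange rules. -/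

section Identities

variable {R : Type*} [CommRing R] {X : Type*}

theorem freeCompatibleBracket_swap (c : BracketColor) (x y : FreeCompatibleLie R X) :
    freeCompatibleBracket R X c y x = -freeCompatibleBracket R X c x y := by
  obtain ⟨x, rfl⟩ := Submodule.Quotient.mk_surjective _ x
  obtain ⟨y, rfl⟩ := Submodule.Quotient.mk_surjective _ y
  refine eq_neg_of_add_eq_zero_left ?_
  exact (Submodule.Quotient.mk_eq_zero _).2
    ((isCompatibleLieIdeal_compatibleLieIdeal R X).antisymm_mem c y x)

theorem freeCompatibleBracket_jacobi (c : BracketColor) (x y z : FreeCompatibleLie R X) :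
    freeCompatibleBracket R X c x (freeCompatibleBracket R X c y z)
      + freeCompatibleBracket R X c y (freeCompatibleBracket R X c z x)
      + freeCompatibleBracket R X c z (freeCompatibleBracket R X c x y) = 0 := by
  obtain ⟨x, rfl⟩ := Submodule.Quotient.mk_surjective _ x
  obtain ⟨y, rfl⟩ := Submodule.Quotient.mk_surjective _ y
  obtain ⟨z, rfl⟩ := Submodule.Quotient.mk_surjective _ z
  exact (Submodule.Quotient.mk_eq_zero _).2
    ((isCompatibleLieIdeal_compatibleLieIdeal R X).jacobi_mem c x y z)

theorem freeCompatibleBracket_mixed_jacobi {c d : BracketColor} (h : c ≠ d)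
    (x y z : FreeCompatibleLie R X) :
    freeCompatibleBracket R X c x (freeCompatibleBracket R X d y z)
      + freeCompatibleBracket R X c y (freeCompatibleBracket R X d z x)
      + freeCompatibleBracket R X c z (freeCompatibleBracket R X d x y)
      + freeCompatibleBracket R X d x (freeCompatibleBracket R X c y z)
      + freeCompatibleBracket R X d y (freeCompatibleBracket R X c z x)
      + freeCompatibleBracket R X d z (freeCompatibleBracket R X c x y) = 0 := by
  have key : freeCompatibleBracket R X .red x (freeCompatibleBracket R X .blue y z)
      + freeCompatibleBracket R X .red y (freeCompatibleBracket R X .blue z x)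
      + freeCompatibleBracket R X .red z (freeCompatibleBracket R X .blue x y)
      + freeCompatibleBracket R X .blue x (freeCompatibleBracket R X .red y z)
      + freeCompatibleBracket R X .blue y (freeCompatibleBracket R X .red z x)
      + freeCompatibleBracket R X .blue z (freeCompatibleBracket R X .red x y) = 0 := by
    obtain ⟨x, rfl⟩ := Submodule.Quotient.mk_surjective _ x
    obtain ⟨y, rfl⟩ := Submodule.Quotient.mk_surjective _ y
    obtain ⟨z, rfl⟩ := Submodule.Quotient.mk_surjective _ z
    exact (Submodule.Quotient.mk_eq_zero _).2
      ((isCompatibleLieIdeal_compatibleLieIdeal R X).mixed_jacobi_mem x y z)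
  cases c <;> cases d
  · exact (h rfl).elim
  · exact key
  · rw [← key]
    abel
  · exact (h rfl).elim

theorem freeCompatibleBracket_exchange (c : BracketColor) (x y z : FreeCompatibleLie R X) :
    freeCompatibleBracket R X c (freeCompatibleBracket R X c x y) z
      - freeCompatibleBracket R X c (freeCompatibleBracket R X c x z) y =
    freeCompatibleBracket R X c x (freeCompatibleBracket R X c y z) := by
  have h := freeCompatibleBracket_jacobi c x y z
  rw [freeCompatibleBracket_swap c x z, map_neg,
    freeCompatibleBracket_swap c (freeCompatibleBracket R X c x z) y,
    freeCompatibleBracket_swap c (freeCompatibleBracket R X c x y) z] at h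
  rw [← sub_eq_zero, ← neg_eq_zero, ← h]
  abel

/-- The left side is the difference made by exchanging `y` and `z`. When the root of `x` wins both
brackets, the four terms on the right have smaller trees. -/
theorem freeCompatibleBracket_mixed_exchange {c d : BracketColor} (hcd : c ≠ d)
    (x y z : FreeCompatibleLie R X) :
    freeCompatibleBracket R X d (freeCompatibleBracket R X c x y) z
      - freeCompatibleBracket R X c (freeCompatibleBracket R X d x z) y =
    freeCompatibleBracket R X c x (freeCompatibleBracket R X d y z)
      - freeCompatibleBracket R X c z (freeCompatibleBracket R X d y x)
      - freeCompatibleBracket R X d x (freeCompatibleBracket R X c z y)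
      + freeCompatibleBracket R X d y (freeCompatibleBracket R X c z x) := by
  have h := freeCompatibleBracket_mixed_jacobi hcd x y z
  rw [freeCompatibleBracket_swap d x z, map_neg,
    freeCompatibleBracket_swap c (freeCompatibleBracket R X d x z) y,
    freeCompatibleBracket_swap d y x, map_neg, freeCompatibleBracket_swap c z y, map_neg,
    freeCompatibleBracket_swap d (freeCompatibleBracket R X c x y) z] at h
  rw [← sub_eq_zero, ← neg_eq_zero, ← h]
  abel

end Identities

/-! ### Spanning: monomials with the same tree agree up to sign and lower terms. -/

namespace BracketMonomial

theorem perm_br_swap {X : Type*} (c : BracketColor) (a b : BracketMonomial X) :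
    (br c a b).letters.Perm (br c b a).letters :=
  List.perm_append_comm

theorem perm_br_left {X : Type*} {c : BracketColor} {a a' : BracketMonomial X} (b : BracketMonomial X)
    (h : a'.letters.Perm a.letters) : (br c a' b).letters.Perm (br c a b).letters :=
  h.append_right _

theorem eval_br_swap {R : Type*} [CommRing R] {X : Type*} (c : BracketColor) (a b : BracketMonomial X) :
    (br c b a).eval R = -(br c a b).eval R :=
  freeCompatibleBracket_swap c _ _

section Reduction

variable {X : Type*} [LinearOrder X]

/-- The tree of `m'` is compatible with `m`. -/
structure Reduces (m' m : BracketMonomial X) : Prop where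
  perm : m'.letters.Perm m.letters
  compat : Compat m'.arcs m m'.graphicalRoot

/-- `m'` is reached from `m` by a chain of reductions and has a different tree. -/
structure Below (m' m : BracketMonomial X) : Prop where
  chain : Relation.ReflTransGen Reduces m' m
  ne : m'.arcs ≠ m.arcs

theorem perm_of_chain {m' m : BracketMonomial X} (h : Relation.ReflTransGen Reduces m' m) :
    m'.letters.Perm m.letters := by
  induction h with
  | refl => exact .refl _
  | tail _ h ih => exact ih.trans h.perm

theorem reduces_of_arcs_eq {m m' : BracketMonomial X} (hm : m.letters.Nodup)
    (hl : m'.letters.Perm m.letters) (h : m'.arcs = m.arcs) : Reduces m' m := by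
  refine ⟨hl, ?_⟩
  rw [h, root_eq_of_arcs_eq (hl.nodup_iff.2 hm) hl h]
  exact compat_arcs hm

/-- Whichever factor wins, the new arc joins `a'.graphicalRoot` and `b.graphicalRoot`, which are the
roots in the compatibility of the two factors. -/
theorem Reduces.br_left {c : BracketColor} {a a' b : BracketMonomial X} (h : Reduces a' a)
    (hm : (br c a b).letters.Nodup) : Reduces (br c a' b) (br c a b) := by
  have hp : (br c a' b).letters.Perm (br c a b).letters := perm_br_left b h.perm
  have hm' := hp.nodup_iff.2 hm
  refine ⟨hp, ?_⟩
  have hA : Compat (br c a' b).arcs a a'.graphicalRoot :=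
    h.compat.mono fun x hx => by simp [arcs, hx]
  have hB : Compat (br c a' b).arcs b b.graphicalRoot :=
    (compat_arcs (nodup_br.1 hm).2.1).mono fun x hx => by simp [arcs, hx]
  rcases wins_or (root_ne_of_nodup hm') c with hw | hw
  · rw [hw.root]
    exact .left hA hB hA.root_mem (by simp [hw.arcs]) hw.color
  · rw [graphicalRoot_comm, hw.root]
    exact .right hA hB hB.root_mem (by simp [arcs_comm c a' b, hw.arcs]) hw.color

theorem chain_br_left {c : BracketColor} {a a' b : BracketMonomial X}
    (h : Relation.ReflTransGen Reduces a' a) (hm : (br c a b).letters.Nodup) :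
    Relation.ReflTransGen Reduces (br c a' b) (br c a b) := by
  induction h with
  | refl => exact .refl
  | tail _ h ih => exact (ih ((perm_br_left b h.perm).nodup_iff.2 hm)).tail (h.br_left hm)

/-- The trees stay different because the tree of a factor is the restriction of the whole tree to
its letters. -/
theorem Below.br_left {c : BracketColor} {a a' b : BracketMonomial X} (h : Below a' a)
    (hm : (br c a b).letters.Nodup) : Below (br c a' b) (br c a b) := by
  refine ⟨chain_br_left h.chain hm, fun heq => h.ne ?_⟩
  have hp := perm_of_chain h.chain
  ext ⟨i, j⟩
  rw [mem_arcs_left hm, mem_arcs_left ((perm_br_left b hp).nodup_iff.2 hm), heq, hp.mem_iff,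
    hp.mem_iff]

theorem arcs_ne_of_mem {m m' : BracketMonomial X} (hm : m.letters.Nodup) {x y k : X}
    (hx : (x, k) ∈ m'.arcs) (hy : (y, k) ∈ m.arcs) (hxy : x ≠ y) : m'.arcs ≠ m.arcs :=
  fun h => hxy (indegreeLeOne_arcs hm (h ▸ hx) hy)

variable (R : Type*) [CommRing R]

/-- The span of the values of the monomials below `m`. -/
noncomputable def belowSpan (m : BracketMonomial X) : Submodule R (FreeCompatibleLie R X) :=
  Submodule.span R ((fun m' => m'.eval R) '' {m' | Below m' m})

variable {R} in
theorem Below.eval_mem {m' m : BracketMonomial X} (h : Below m' m) :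
    m'.eval R ∈ belowSpan R m :=
  Submodule.subset_span ⟨m', h, rfl⟩

theorem belowSpan_le_of_arcs_eq {m m' : BracketMonomial X} (hm : m.letters.Nodup)
    (hl : m'.letters.Perm m.letters) (h : m'.arcs = m.arcs) :
    belowSpan R m' ≤ belowSpan R m := by
  refine Submodule.span_mono (Set.image_mono fun n hn => ?_)
  exact ⟨hn.chain.tail (reduces_of_arcs_eq hm hl h), h ▸ hn.ne⟩

/-- `m` and `m'` have the same tree and their values agree up to a sign and up to values of
monomials below them. -/
structure Sim (m m' : BracketMonomial X) : Prop where
  perm : m.letters.Perm m'.letters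
  arcs_eq : m.arcs = m'.arcs
  sub_mem : ∃ u : ℤˣ, m.eval R - (u : ℤ) • m'.eval R ∈ belowSpan R m'

variable {R}

theorem Sim.refl (m : BracketMonomial X) : Sim R m m :=
  ⟨.refl _, rfl, 1, by simp⟩

theorem Sim.symm {m m' : BracketMonomial X} (h : Sim R m m') (hm : m.letters.Nodup) :
    Sim R m' m := by
  obtain ⟨hp, ha, u, hu⟩ := h
  have hu' := belowSpan_le_of_arcs_eq R hm hp.symm ha.symm hu
  refine ⟨hp.symm, ha.symm, u, ?_⟩
  rcases Int.units_eq_one_or u with rfl | rfl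
  · simpa using Submodule.neg_mem _ hu'
  · simpa [add_comm] using hu'

theorem Sim.trans {m m' m'' : BracketMonomial X} (h : Sim R m m') (h' : Sim R m' m'')
    (hm : m.letters.Nodup) : Sim R m m'' := by
  obtain ⟨hp, ha, u, hu⟩ := h
  obtain ⟨hp', ha', v, hv⟩ := h'
  have hu' := belowSpan_le_of_arcs_eq R ((hp.trans hp').nodup_iff.1 hm) hp' ha' hu
  refine ⟨hp.trans hp', ha.trans ha', u * v, ?_⟩
  convert Submodule.add_mem _ hu' (Submodule.smul_of_tower_mem _ (u : ℤ) hv) using 1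
  rw [smul_sub, Units.val_mul, mul_smul]
  abel

theorem Sim.br_swap (c : BracketColor) (a b : BracketMonomial X) :
    Sim R (br c a b) (br c b a) :=
  ⟨perm_br_swap c a b, arcs_comm c a b, -1, by simp [eval_br_swap c a b]⟩

theorem Sim.br_left {c : BracketColor} {a a' b : BracketMonomial X} (h : Sim R a a')
    (hm : (br c a b).letters.Nodup) : Sim R (br c a b) (br c a' b) := by
  obtain ⟨hp, ha, u, hu⟩ := h
  have hm' := (perm_br_left b hp).nodup_iff.1 hm
  refine ⟨perm_br_left b hp, ?_, u, ?_⟩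
  · rw [arcs, arcs, ha, root_eq_of_arcs_eq (nodup_br.1 hm).1 hp ha]
  · have hle : belowSpan R a' ≤
        (belowSpan R (br c a' b)).comap ((freeCompatibleBracket R X c).flip (b.eval R)) := by
      refine Submodule.span_le.2 ?_
      rintro _ ⟨n, hn, rfl⟩
      exact (hn.br_left hm').eval_mem
    have := hle hu
    rw [Submodule.mem_comap, map_sub, map_zsmul] at this
    exact this

theorem Sim.br_right {c : BracketColor} {a b b' : BracketMonomial X} (h : Sim R b b')
    (hm : (br c a b).letters.Nodup) : Sim R (br c a b) (br c a b') :=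
  ((Sim.br_swap c a b).trans (h.br_left (nodup_swap hm)) hm).trans (Sim.br_swap c b' a) hm

/-- Different colours put `v` strictly between `s` and `t`, and this fixes every other arc colour
among the three. -/
theorem other_color {c d : BracketColor} (h : c ≠ d) {v s t : X} (hs : arcColor v s = c)
    (ht : arcColor v t = d) (hvs : v ≠ s) (hvt : v ≠ t) :
    s ≠ t ∧ arcColor t s = c ∧ arcColor s t = d ∧ arcColor t v = c ∧ arcColor s v = d := by
  subst hs ht
  rcases lt_or_gt_of_ne hvs with h1 | h1 <;> rcases lt_or_gt_of_ne hvt with h2 | h2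
  · simp [arcColor, h1, h2] at h
  · have := h2.trans h1
    simp [arcColor, h1, h2, h1.not_gt, h2.not_gt, this, this.not_gt, this.ne']
  · have := h1.trans h2
    simp [arcColor, h1, h2, h1.not_gt, h2.not_gt, this, this.not_gt, this.ne]
  · simp [arcColor, h1.not_gt, h2.not_gt] at h

/-- Two consecutive factors at the root can be exchanged. -/
theorem Sim.exchange {c d : BracketColor} {a s t : BracketMonomial X}
    (hm : (br d (br c a s) t).letters.Nodup) (hs : Wins c a s) (ht : Wins d a t) :
    Sim R (br d (br c a s) t) (br c (br d a t) s) := by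
  have hp : (br d (br c a s) t).letters.Perm (br c (br d a t) s).letters :=
    List.perm_iff_count.2 fun x => by simp only [letters, List.count_append]; omega
  have hm' := hp.nodup_iff.1 hm
  have hna := (nodup_br.1 (nodup_br.1 hm).1).1
  have hns := (nodup_br.1 (nodup_br.1 hm).1).2.1
  have hnt := (nodup_br.1 hm).2.1
  have hw : Wins d (br c a s) t := ⟨by rw [hs.root]; exact ht.ne, by rw [hs.root]; exact ht.color⟩
  have hw' : Wins c (br d a t) s :=
    ⟨by rw [ht.root]; exact hs.ne, by rw [ht.root]; exact hs.color⟩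
  have harcs : (br d (br c a s) t).arcs = (br c (br d a t) s).arcs := by
    rw [hw.arcs, hw'.arcs, hs.arcs, ht.arcs, hs.root, ht.root]
    ext x
    simp only [Finset.mem_insert, Finset.mem_union]
    tauto
  have hred : Reduces (br d (br c a s) t) (br c (br d a t) s) := reduces_of_arcs_eq hm' hp harcs
  have hst : s.graphicalRoot ≠ t.graphicalRoot := fun h =>
    (nodup_br.1 hm).2.2 (mem_letters_br.2 (.inr s.graphicalRoot_mem)) (h ▸ t.graphicalRoot_mem)
  have has' : (a.graphicalRoot, s.graphicalRoot) ∈ (br c (br d a t) s).arcs := by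
    simp [hw'.arcs, ht.root]
  have hat' : (a.graphicalRoot, t.graphicalRoot) ∈ (br c (br d a t) s).arcs := by
    simp [hw'.arcs, ht.arcs]
  have hsa : ∀ n : BracketMonomial X, a.arcs ⊆ n.arcs → Compat n.arcs a a.graphicalRoot :=
    fun n hn => (compat_arcs hna).mono hn
  have hss : ∀ n : BracketMonomial X, s.arcs ⊆ n.arcs → Compat n.arcs s s.graphicalRoot :=
    fun n hn => (compat_arcs hns).mono hn
  have hstt : ∀ n : BracketMonomial X, t.arcs ⊆ n.arcs → Compat n.arcs t t.graphicalRoot :=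
    fun n hn => (compat_arcs hnt).mono hn
  refine ⟨hp, harcs, 1, ?_⟩
  rw [Units.val_one, one_smul]
  -- Equal colours leave the single Jacobi term; its tree moves one of the two children of
  -- `a.graphicalRoot` below the other.
  by_cases hcd : c = d
  · subst hcd
    have hJ : (br c (br c a s) t).eval R - (br c (br c a t) s).eval R =
        (br c a (br c s t)).eval R :=
      freeCompatibleBracket_exchange c _ _ _
    rw [hJ]
    refine Below.eval_mem ?_
    rcases wins_or hst c with h | h
    · have h1 : Wins c a (br c s t) := ⟨by rw [h.root]; exact hs.ne, by rw [h.root]; exact hs.color⟩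
      have hT := h1.arcs
      rw [h.arcs, h.root] at hT
      have hr : Reduces (br c a (br c s t)) (br c (br c a s) t) := by
        refine ⟨List.perm_iff_count.2 fun x => by simp only [letters, List.count_append]; omega, ?_⟩
        rw [h1.root]
        refine .left (.left (hsa _ ?_) (hss _ ?_) a.graphicalRoot_mem ?_ hs.color) (hstt _ ?_)
          (mem_letters_br.2 (.inr s.graphicalRoot_mem)) ?_ h.color <;> rw [hT] <;> grind
      refine ⟨.tail (.single hr) hred, arcs_ne_of_mem hm' (y := a.graphicalRoot)
        (k := t.graphicalRoot) (x := s.graphicalRoot) ?_ hat' hs.ne.symm⟩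
      rw [hT]
      simp
    · have hcs : (br c s t).graphicalRoot = t.graphicalRoot := by rw [graphicalRoot_comm, h.root]
      have h1 : Wins c a (br c s t) := ⟨by rw [hcs]; exact ht.ne, by rw [hcs]; exact ht.color⟩
      have hT := h1.arcs
      rw [arcs_comm c s t, h.arcs, hcs] at hT
      have hr : Reduces (br c a (br c s t)) (br c (br c a t) s) := by
        refine ⟨List.perm_iff_count.2 fun x => by simp only [letters, List.count_append]; omega, ?_⟩
        rw [h1.root]
        refine .left (.left (hsa _ ?_) (hstt _ ?_) a.graphicalRoot_mem ?_ ht.color) (hss _ ?_)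
          (mem_letters_br.2 (.inr t.graphicalRoot_mem)) ?_ h.color <;> rw [hT] <;> grind
      refine ⟨.single hr, arcs_ne_of_mem hm' (y := a.graphicalRoot)
        (k := s.graphicalRoot) (x := t.graphicalRoot) ?_ has' ht.ne.symm⟩
      rw [hT]
      simp
  · obtain ⟨-, hts, hst', hta, hsa'⟩ := other_color hcd hs.color ht.color hs.ne ht.ne
    have wts : Wins c t s := ⟨hst.symm, hts⟩
    have wst : Wins d s t := ⟨hst, hst'⟩
    have wta : Wins c t a := ⟨ht.ne.symm, hta⟩
    have wsa : Wins d s a := ⟨hs.ne.symm, hsa'⟩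
    have w1 : Wins d a (br c t s) := ⟨by rw [wts.root]; exact ht.ne, by rw [wts.root]; exact ht.color⟩
    have w2 : Wins c a (br d s t) := ⟨by rw [wst.root]; exact hs.ne, by rw [wst.root]; exact hs.color⟩
    have w3 : Wins d s (br c t a) := ⟨by rw [wta.root]; exact hst, by rw [wta.root]; exact hst'⟩
    have w4 : Wins c t (br d s a) := ⟨by rw [wsa.root]; exact hst.symm, by rw [wsa.root]; exact hts⟩
    have T1 := w1.arcs
    have T2 := w2.arcs
    have T3 := w3.arcs
    have T4 := w4.arcs
    rw [wts.arcs, wts.root] at T1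
    rw [wst.arcs, wst.root] at T2
    rw [wta.arcs, wta.root] at T3
    rw [wsa.arcs, wsa.root] at T4
    have hJ : (br d (br c a s) t).eval R - (br c (br d a t) s).eval R =
        (br c a (br d s t)).eval R - (br c t (br d s a)).eval R - (br d a (br c t s)).eval R
          + (br d s (br c t a)).eval R :=
      freeCompatibleBracket_mixed_exchange hcd _ _ _
    have r1 : Reduces (br d a (br c t s)) (br c (br d a t) s) := by
      refine ⟨List.perm_iff_count.2 fun x => by simp only [letters, List.count_append]; omega, ?_⟩
      rw [w1.root]
      refine .left (.left (hsa _ ?_) (hstt _ ?_) a.graphicalRoot_mem ?_ ht.color) (hss _ ?_)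
          (mem_letters_br.2 (.inr t.graphicalRoot_mem)) ?_ hts <;> rw [T1] <;> grind
    have r2 : Reduces (br c a (br d s t)) (br d (br c a s) t) := by
      refine ⟨List.perm_iff_count.2 fun x => by simp only [letters, List.count_append]; omega, ?_⟩
      rw [w2.root]
      refine .left (.left (hsa _ ?_) (hss _ ?_) a.graphicalRoot_mem ?_ hs.color) (hstt _ ?_)
          (mem_letters_br.2 (.inr s.graphicalRoot_mem)) ?_ hst' <;> rw [T2] <;> grind
    -- This tree has no arc between the letters of `a` and those of `s`, so it is not compatible
    -- with `br d (br c a s) t` itself and is reached through an intermediate monomial. This is why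
    -- `Below` allows chains.
    have r3 : Reduces (br d s (br c t a)) (br c a (br d s t)) := by
      refine ⟨List.perm_iff_count.2 fun x => by simp only [letters, List.count_append]; omega, ?_⟩
      rw [w3.root]
      refine .right (hsa _ ?_) (.left (hss _ ?_) (hstt _ ?_) s.graphicalRoot_mem ?_ hst')
          (mem_letters_br.2 (.inr t.graphicalRoot_mem)) ?_ hta <;> rw [T3] <;> grind
    have r4 : Reduces (br c t (br d s a)) (br d a (br c t s)) := by
      refine ⟨List.perm_iff_count.2 fun x => by simp only [letters, List.count_append]; omega, ?_⟩
      rw [w4.root]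
      refine .right (hsa _ ?_) (.left (hstt _ ?_) (hss _ ?_) t.graphicalRoot_mem ?_ hts)
          (mem_letters_br.2 (.inr s.graphicalRoot_mem)) ?_ hsa' <;> rw [T4] <;> grind
    rw [hJ]
    refine Submodule.add_mem _ (Submodule.sub_mem _ (Submodule.sub_mem _ (Below.eval_mem ?_)
      (Below.eval_mem ?_)) (Below.eval_mem ?_)) (Below.eval_mem ?_)
    · exact ⟨.tail (.single r2) hred, arcs_ne_of_mem hm' (x := s.graphicalRoot)
        (by rw [T2]; simp) hat' hs.ne.symm⟩
    · exact ⟨.tail (.single r4) r1, arcs_ne_of_mem hm' (x := t.graphicalRoot)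
        (by rw [T4]; simp) has' ht.ne.symm⟩
    · exact ⟨.single r1, arcs_ne_of_mem hm' (x := t.graphicalRoot)
        (by rw [T1]; simp) has' ht.ne.symm⟩
    · exact ⟨.tail (.tail (.single r3) r2) hred, arcs_ne_of_mem hm' (x := s.graphicalRoot)
        (by rw [T3]; simp) hat' hs.ne.symm⟩

/-- Every child of the root can be made the root of the last factor. -/
theorem exists_sim_br {m : BracketMonomial X} (hm : m.letters.Nodup) {x : X} :
    (m.graphicalRoot, x) ∈ m.arcs →
      ∃ c a b, Wins c a b ∧ b.graphicalRoot = x ∧ Sim R m (br c a b) := by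
  induction m, hm using nodup_induction with
  | hl y _ => simp [arcs]
  | hs c a b hm' hm h =>
    rw [arcs_comm, graphicalRoot_comm]
    intro hx
    obtain ⟨d, a', b', hw, hb, hs⟩ := h hx
    exact ⟨d, a', b', hw, hb, (Sim.br_swap c a b).trans hs hm⟩
  | hbr c a b hm hw ha hb =>
    intro hx
    obtain ⟨hna, hnb, hd⟩ := nodup_br.1 hm
    rw [hw.arcs, hw.root, Finset.mem_insert, Finset.mem_union, Prod.mk.injEq] at hx
    rcases hx with hx | hx | hx
    · exact ⟨c, a, b, hw, hx.2.symm, Sim.refl _⟩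
    · obtain ⟨d, a', b', hw', hb', hs⟩ := ha hx
      have hroot : a.graphicalRoot = a'.graphicalRoot := by
        rw [root_eq_of_arcs_eq hna hs.perm hs.arcs_eq, hw'.root]
      have h1 : Sim R (br c a b) (br c (br d a' b') b) := hs.br_left hm
      have hw2 : Wins c a' b := ⟨hroot ▸ hw.ne, hroot ▸ hw.color⟩
      -- The wanted child is last in `a` by induction; the exchange carries it past `b`.
      refine ⟨d, br c a' b, b', ⟨?_, ?_⟩, hb', h1.trans
        (Sim.exchange (h1.perm.nodup_iff.1 hm) hw' hw2) hm⟩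
      · rw [hw2.root]
        exact hw'.ne
      · rw [hw2.root]
        exact hw'.color
    · exact (hd a.graphicalRoot_mem (mem_of_mem_arcs hx).1).elim

/-- The letters of the last factor are the subtree below its root: only the arc into that root
crosses the partition, and each factor is connected by its own arcs. -/
theorem letters_subset_of_arcs_eq {c c' : BracketColor} {a b a' b' : BracketMonomial X}
    (hm : (br c a b).letters.Nodup) (hm' : (br c' a' b').letters.Nodup)
    (hw' : Wins c' a' b') (harcs : (br c a b).arcs = (br c' a' b').arcs)
    (ha : a.graphicalRoot = a'.graphicalRoot) (hb : b.graphicalRoot = b'.graphicalRoot) :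
    (∀ x ∈ a.letters, x ∉ b'.letters) ∧ ∀ x ∈ b.letters, x ∈ b'.letters := by
  obtain ⟨hna, hnb, hd⟩ := nodup_br.1 hm
  obtain ⟨hna', hnb', hd'⟩ := nodup_br.1 hm'
  have key : ∀ i j, (i, j) ∈ (br c a b).arcs → j ≠ b.graphicalRoot →
      (i ∈ b'.letters ↔ j ∈ b'.letters) := by
    intro i j hij hj
    rw [harcs, hw'.arcs, Finset.mem_insert, Finset.mem_union, Prod.mk.injEq] at hij
    rcases hij with h | h | h
    · exact (hj (h.2.trans hb.symm)).elim
    · have h1 : i ∉ b'.letters := fun h' => hd' (mem_of_mem_arcs h).1 h'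
      have h2 : j ∉ b'.letters := fun h' => hd' (mem_of_mem_arcs h).2 h'
      exact iff_of_false h1 h2
    · exact iff_of_true (mem_of_mem_arcs h).1 (mem_of_mem_arcs h).2
  constructor
  · refine forall_letters_of_arcs hna (fun x => x ∉ b'.letters) (fun i j hij => ?_) ?_
    · refine not_congr (key i j (by simp [arcs, hij]) fun h => ?_)
      exact hd (h ▸ (mem_of_mem_arcs hij).2) b.graphicalRoot_mem
    · rw [ha]
      exact fun h => hd' a'.graphicalRoot_mem h
  · refine forall_letters_of_arcs hnb (fun x => x ∈ b'.letters) (fun i j hij => ?_) ?_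
    · refine key i j (by simp [arcs, hij]) fun h => ?_
      exact not_mem_arcs_root hnb i (h ▸ hij)
    · rw [hb]
      exact b'.graphicalRoot_mem

/-- Monomials with the same tree are similar. -/
theorem sim_of_arcs_eq {m : BracketMonomial X} (hm : m.letters.Nodup) :
    ∀ m' : BracketMonomial X, m.letters.Perm m'.letters → m.arcs = m'.arcs → Sim R m m' := by
  induction m, hm using nodup_induction with
  | hl x _ =>
    intro m' hp _
    cases m' with
    | letter y =>
      have : x = y := by simpa [letters] using hp
      exact this ▸ Sim.refl _
    | br c a b =>
      have h1 := hp.length_eq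
      -- Used only to see that each factor has at least one letter, so a product has at least two.
      have h2 := a.card_arcs_lt
      have h3 := b.card_arcs_lt
      simp only [letters, List.length_append, List.length_singleton] at h1
      omega
  | hs c a b _ hm h =>
    intro m' hp harcs
    exact (Sim.br_swap c a b).trans
      (h m' ((perm_br_swap c b a).trans hp) ((arcs_comm c b a).trans harcs)) hm
  | hbr c a b hm hw ha hb =>
    intro m' hp harcs
    have hm' := hp.nodup_iff.1 hm
    have hroot := root_eq_of_arcs_eq hm hp harcs
    have hmem : (m'.graphicalRoot, b.graphicalRoot) ∈ m'.arcs := by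
      rw [← harcs, ← hroot, hw.root, hw.arcs]
      simp
    -- After rearranging `m'`, both monomials split off the same child of the root, hence the same
    -- subtrees.
    obtain ⟨c', a', b', hw', hb', hs⟩ := exists_sim_br (R := R) hm' hmem
    have hroot' : a.graphicalRoot = a'.graphicalRoot := by
      rw [← hw.root, ← hw'.root, hroot, root_eq_of_arcs_eq hm' hs.perm hs.arcs_eq]
    obtain rfl : c = c' := by rw [← hw.color, ← hw'.color, hroot', hb']
    have hm'' := hs.perm.nodup_iff.1 hm'
    have harcs' := harcs.trans hs.arcs_eq
    have hp' := hp.trans hs.perm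
    obtain ⟨hna, hnb, hd⟩ := nodup_br.1 hm
    obtain ⟨hna', hnb', hd'⟩ := nodup_br.1 hm''
    have h1 := letters_subset_of_arcs_eq hm hm'' hw' harcs' hroot' hb'.symm
    have h2 := letters_subset_of_arcs_eq hm'' hm hw harcs'.symm hroot'.symm hb'
    have hpb : ∀ x, x ∈ b.letters ↔ x ∈ b'.letters := fun x => ⟨h1.2 x, h2.2 x⟩
    have hpa : ∀ x, x ∈ a.letters ↔ x ∈ a'.letters := fun x => by
      have h3 := hp'.mem_iff (a := x)
      rw [mem_letters_br, mem_letters_br] at h3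
      have h4 := h1.1 x
      have h5 := h2.1 x
      tauto
    have haa : a.arcs = a'.arcs := by
      ext ⟨i, j⟩
      rw [mem_arcs_left hm, mem_arcs_left hm'', harcs', hpa, hpa]
    have hbb : b.arcs = b'.arcs := by
      ext ⟨i, j⟩
      rw [mem_arcs_right hm, mem_arcs_right hm'', harcs', hpb, hpb]
    have s1 : Sim R (br c a b) (br c a' b) :=
      (ha a' ((List.perm_ext_iff_of_nodup hna hna').2 hpa) haa).br_left hm
    have s2 : Sim R (br c a' b) (br c a' b') :=
      (hb b' ((List.perm_ext_iff_of_nodup hnb hnb').2 hpb) hbb).br_right (s1.perm.nodup_iff.1 hm)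
    exact (s1.trans s2 hm).trans (hs.symm hm') hm

theorem IsMultilinear.of_perm {m m' : BracketMonomial X} (hm : m.IsMultilinear)
    (h : m'.letters.Perm m.letters) : m'.IsMultilinear := fun x => by
  rw [h.count_eq, hm x]

theorem treeKey_lt_of_below [Fintype X] {m m' : BracketMonomial X} (hm : m.IsMultilinear)
    (h : Below m' m) : treeKey m'.arcs < treeKey m.arcs := by
  obtain ⟨hc, hne⟩ := h
  have : m'.arcs = m.arcs ∨ treeKey m'.arcs < treeKey m.arcs := by
    clear hne
    induction hc with
    | refl => exact .inl rfl
    | tail hc h ih =>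
      have hy := hm.of_perm h.perm
      rcases arcs_eq_or_treeKey_lt hm hy h.compat with h1 | h1
      · rw [← h1]
        exact ih hy
      · exact .inr ((ih hy).elim (fun h2 => h2 ▸ h1) (fun h2 => h2.trans h1))
  exact this.resolve_left hne

/-- The values of monomials with every possible tree span. -/
theorem eval_mem_span [Fintype X] (S : Set (BracketMonomial X))
    (hS : ∀ m : BracketMonomial X, m.IsMultilinear →
      ∃ m' ∈ S, m'.IsMultilinear ∧ m'.arcs = m.arcs)
    (m : BracketMonomial X) (hm : m.IsMultilinear) :
    m.eval R ∈ Submodule.span R ((fun m' => m'.eval R) '' S) := by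
  -- The target order of the key is not well-founded; finiteness of the set of arc sets is what is
  -- used.
  have wf : WellFounded (fun T T' : Finset (X × X) => treeKey T < treeKey T') :=
    Finite.wellFounded_of_trans_of_irrefl _
  generalize hT : m.arcs = T
  induction T using wf.induction generalizing m with
  | h T ih =>
    subst hT
    obtain ⟨s, hs, hsm, harcs⟩ := hS m hm
    have hp : m.letters.Perm s.letters :=
      List.perm_iff_count.2 fun x => (hm x).trans (hsm x).symm
    obtain ⟨-, -, u, hu⟩ := sim_of_arcs_eq (R := R) hm.nodup s hp harcs.symm
    have hle : belowSpan R s ≤ Submodule.span R ((fun m' => m'.eval R) '' S) := by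
      refine Submodule.span_le.2 ?_
      rintro _ ⟨n, hn, rfl⟩
      exact ih n.arcs (harcs ▸ treeKey_lt_of_below hsm hn) n
        (hsm.of_perm (perm_of_chain hn.chain)) rfl
    rw [← sub_add_cancel (m.eval R) ((u : ℤ) • s.eval R)]
    exact Submodule.add_mem _ (hle hu)
      (Submodule.smul_of_tower_mem _ _ (Submodule.subset_span ⟨s, hs, rfl⟩))

end Reduction

end BracketMonomial

/-! ### Coloured graphs and linear independence. -/

namespace BracketMonomial

section Graphs

variable {X : Type*} [LinearOrder X]

theorem graph_adj_comm (c d : BracketColor) (a b : BracketMonomial X) (i j : X) :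
    ((br c a b).graph d).Adj i j ↔ ((br c b a).graph d).Adj i j := by
  simp only [graph]
  rw [sup_comm (a.graph d), SimpleGraph.edge_comm]

theorem graph_adj {m : BracketMonomial X} (hm : m.letters.Nodup) :
    ∀ (c : BracketColor) (i j : X), (m.graph c).Adj i j ↔
      ((i, j) ∈ m.arcs ∧ arcColor i j = c) ∨ ((j, i) ∈ m.arcs ∧ arcColor j i = c) := by
  induction m, hm using nodup_induction with
  | hl x _ => simp [graph, arcs]
  | hs c a b _ _ h =>
    intro d i j
    rw [graph_adj_comm, arcs_comm]
    exact h d i j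
  | hbr c a b hm hw ha hb =>
    intro d i j
    have he : (if d = c then SimpleGraph.edge a.graphicalRoot b.graphicalRoot else ⊥).Adj i j ↔
        ((i = a.graphicalRoot ∧ j = b.graphicalRoot) ∧ arcColor i j = d) ∨
          ((j = a.graphicalRoot ∧ i = b.graphicalRoot) ∧ arcColor j i = d) := by
      have h1 := hw.ne
      have h2 := hw.color
      split_ifs with h
      · subst h
        rw [SimpleGraph.edge_adj]
        grind
      · simp only [SimpleGraph.bot_adj, false_iff]
        grind
    simp only [graph, SimpleGraph.sup_adj, ha d i j, hb d i j, he, hw.arcs, Finset.mem_insert,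
      Finset.mem_union, Prod.mk.injEq, or_and_right]
    rw [← eq_iff_iff]
    ac_rfl

/-- The colour of an edge, together with the order of its ends, recovers the direction of the arc.
-/
theorem mem_arcs_iff_graph_adj {m : BracketMonomial X} (hm : m.letters.Nodup) {i j : X}
    (hij : i ≠ j) : (i, j) ∈ m.arcs ↔ (m.graph (arcColor i j)).Adj i j := by
  rw [graph_adj hm]
  have := arcColor_ne_swap hij
  tauto

theorem arcs_eq_of_graph_eq {m m' : BracketMonomial X} (hm : m.letters.Nodup)
    (hm' : m'.letters.Nodup) (h : m.graph = m'.graph) : m.arcs = m'.arcs := by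
  ext ⟨i, j⟩
  by_cases hij : i = j
  · exact iff_of_false (fun h' => ne_of_mem_arcs hm _ _ h' hij)
      (fun h' => ne_of_mem_arcs hm' _ _ h' hij)
  · rw [mem_arcs_iff_graph_adj hm hij, mem_arcs_iff_graph_adj hm' hij, h]

theorem graph_eq_of_arcs_eq {m m' : BracketMonomial X} (hm : m.letters.Nodup)
    (hm' : m'.letters.Nodup) (h : m.arcs = m'.arcs) : m.graph = m'.graph := by
  funext c
  ext i j
  rw [graph_adj hm, graph_adj hm', h]

theorem sup_graph_adj {m : BracketMonomial X} (hm : m.letters.Nodup) (i j : X) :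
    (m.graph .red ⊔ m.graph .blue).Adj i j ↔ (i, j) ∈ m.arcs ∨ (j, i) ∈ m.arcs := by
  rw [SimpleGraph.sup_adj, graph_adj hm, graph_adj hm]
  have h : ∀ c : BracketColor, c = .red ∨ c = .blue := fun c => by cases c <;> simp
  have h1 := h (arcColor i j)
  have h2 := h (arcColor j i)
  tauto

/-- The graph is connected and has at most as many edges as there are arcs, which are fewer than the
letters. -/
theorem IsMultilinear.isTree [Fintype X] {m : BracketMonomial X} (hm : m.IsMultilinear) :
    (m.graph .red ⊔ m.graph .blue).IsTree := by
  set G := m.graph .red ⊔ m.graph .blue with hG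
  have hconn : G.Connected := by
    have hr : ∀ x, G.Reachable m.graphicalRoot x := fun x =>
      forall_letters_of_arcs hm.nodup (fun x => G.Reachable m.graphicalRoot x)
        (fun i j hij => by
          have hadj : G.Adj i j := (sup_graph_adj hm.nodup i j).2 (.inl hij)
          exact ⟨fun h => h.trans hadj.reachable, fun h => h.trans hadj.symm.reachable⟩)
        (.refl _) x (hm.mem x)
    exact (SimpleGraph.connected_iff _).2
      ⟨fun x y => (hr x).symm.trans (hr y), ⟨m.graphicalRoot⟩⟩
  rw [SimpleGraph.isTree_iff_connected_and_card]
  refine ⟨hconn, le_antisymm ?_ hconn.card_vert_le_card_edgeSet_add_one⟩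
  have hsub : G.edgeSet ⊆ ((m.arcs.image fun e => s(e.1, e.2) : Finset (Sym2 X)) : Set _) := by
    intro e
    induction e using Sym2.ind with
    | _ i j =>
      intro he
      rw [SimpleGraph.mem_edgeSet, sup_graph_adj hm.nodup] at he
      simp only [Finset.coe_image, Set.mem_image, Finset.mem_coe]
      rcases he with h | h
      · exact ⟨_, h, rfl⟩
      · exact ⟨_, h, Sym2.eq_swap⟩
  have h1 : Nat.card G.edgeSet ≤ m.arcs.card := by
    refine (Nat.card_mono (Finset.finite_toSet _) hsub).trans ?_
    rw [Nat.card_coe_set_eq, Set.ncard_coe_finset]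
    exact Finset.card_image_le
  have h2 : m.letters.length = Nat.card X := by
    rw [← List.toFinset_card_of_nodup hm.nodup, Nat.card_eq_fintype_card, ← Finset.card_univ]
    congr 1
    ext x
    simp [hm.mem x]
  have := m.card_arcs_lt
  omega

/-- Each forbidden pattern says that a vertex has two different parents. -/
theorem IsMultilinear.graph_mem [Fintype X] {m : BracketMonomial X} (hm : m.IsMultilinear) :
    m.graph ∈ twoColoredRootedTrees X := by
  have hI := indegreeLeOne_arcs hm.nodup
  have red : ∀ {i j : X}, i < j → (m.graph .red).Adj i j → (i, j) ∈ m.arcs := fun {i j} h h' =>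
    (mem_arcs_iff_graph_adj hm.nodup h.ne).2 (by rwa [arcColor, if_pos h])
  have blue : ∀ {i j : X}, i < j → (m.graph .blue).Adj i j → (j, i) ∈ m.arcs := fun {i j} h h' =>
    (mem_arcs_iff_graph_adj hm.nodup h.ne').2 (by rw [arcColor, if_neg h.not_gt]; exact h'.symm)
  obtain ⟨D, -, hD⟩ := exists_depth hm.nodup
  refine ⟨⟨?_, hm.isTree⟩, ⟨?_, ?_, ?_⟩⟩
  -- An edge with both colours would be an arc in both directions, and depth would increase both
  -- ways.
  · rw [SimpleGraph.disjoint_left]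
    intro i j h1 h2
    rcases lt_or_gt_of_ne h1.ne with h | h
    · have e1 := hD _ _ (red h h1)
      have e2 := hD _ _ (blue h h2)
      omega
    · have e1 := hD _ _ (red h h1.symm)
      have e2 := hD _ _ (blue h h2.symm)
      omega
  · rintro i j k hij hjk ⟨h1, h2⟩
    exact hij.ne (hI (red (hij.trans hjk) h1) (red hjk h2))
  · rintro i j k hij hjk ⟨h1, h2⟩
    exact hjk.ne (hI (blue hij h1) (blue (hij.trans hjk) h2))
  · rintro i j k hij hjk ⟨h1, h2⟩
    exact (hij.trans hjk).ne (hI (red hij h1) (blue hjk h2))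

/-- The values of multilinear monomials with distinct trees are linearly independent. -/
theorem linearIndependent_eval (R : Type*) [CommRing R] [Fintype X]
    (S : Set (MultilinearMonomial X)) (hS : Set.InjOn (fun m => m.1.arcs) S) :
    LinearIndependent R (fun m : S => m.1.1.eval R) := by
  classical
  rw [linearIndependent_iff]
  intro l hl
  by_contra hne
  -- The functional of a tree with maximal key annihilates every other monomial in the support,
  -- since it can be compatible only with monomials of larger key or the same tree.
  obtain ⟨s, hs, hmax⟩ := Finset.exists_max_image l.support (fun m => treeKey m.1.1.arcs)
    (Finsupp.support_nonempty_iff.2 hne)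
  have h0 := congrArg (treeFunctional R s.1.1.arcs) hl
  rw [Finsupp.linearCombination_apply, Finsupp.sum, map_sum, map_zero,
    Finset.sum_eq_single_of_mem s hs] at h0
  · rw [map_smul, treeFunctional_eval _ s.1.2, smul_eq_mul] at h0
    have hu : IsUnit (treePairing R s.1.1.arcs s.1.1) :=
      isUnit_treePairing s.1.2.nodup subset_rfl fun _ _ _ _ h => h
    exact Finsupp.mem_support_iff.1 hs (hu.mul_left_eq_zero.1 h0)
  · intro m hm hms
    rw [map_smul, treeFunctional_eval _ m.1.2]
    by_contra hne'
    obtain ⟨r, hr⟩ := exists_compat_of_treePairing_ne_zero (R := R)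
      (indegreeLeOne_arcs s.1.2.nodup) m.1.2.nodup (right_ne_zero_of_smul hne')
    rcases arcs_eq_or_treeKey_lt m.1.2 s.1.2 hr with h | h
    · exact hms (Subtype.ext (hS m.2 s.2 h.symm))
    · exact (hmax m hm).not_gt h

end Graphs

end BracketMonomial

open BracketMonomial in
/-- A set `S` of multilinear monomials that `m ↦ m.graph` maps bijectively onto the two-coloured
rooted trees on `X` is a basis of `Lie₂`. -/
theorem mainTheorem4 (R : Type*) [CommRing R] (X : Type*) [LinearOrder X] [Fintype X]
    (S : Set (MultilinearMonomial X))
    (hS : Set.BijOn (fun m : MultilinearMonomial X => m.1.graph) S (twoColoredRootedTrees X)) :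
    ∃ b : Module.Basis S R (Lie₂ R X),
      ∀ m : S, (b m : FreeCompatibleLie R X) = m.1.1.eval R := by
  have hli := linearIndependent_eval R S fun m hm m' hm' h =>
    hS.injOn hm hm' (graph_eq_of_arcs_eq m.2.nodup m'.2.nodup h)
  have hspan : Lie₂ R X = Submodule.span R (Set.range fun m : S => m.1.1.eval R) := by
    refine le_antisymm (Submodule.span_le.2 ?_) (Submodule.span_mono ?_)
    · rintro _ ⟨m, rfl⟩
      have := eval_mem_span (R := R) (Subtype.val '' S) (fun n hn => by
        obtain ⟨s, hs, h⟩ := hS.surjOn hn.graph_mem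
        exact ⟨s.1, ⟨s, hs, rfl⟩, s.2, arcs_eq_of_graph_eq s.2.nodup hn.nodup h⟩) m.1 m.2
      refine Submodule.span_mono ?_ this
      rintro _ ⟨_, ⟨s, hs, rfl⟩, rfl⟩
      exact ⟨⟨s, hs⟩, rfl⟩
    · rintro _ ⟨m, rfl⟩
      exact ⟨m.1, rfl⟩
  refine ⟨(Module.Basis.span hli).map (LinearEquiv.ofEq _ _ hspan.symm), fun m => ?_⟩
  rw [Module.Basis.map_apply, LinearEquiv.coe_ofEq_apply, Module.Basis.span_apply]
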